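/- **Problem.** Let $T\ge 1$, $x_0\in\mathbb R^n$, $\mathcal X_0=\{x_0\}$, $\mathcal X_t\subset\mathbb R^n$, $f_t(\cdot,\cdot,\xi):\mathbb R^n\times\mathbb R^n\to\mathbb R\cup\{+\infty\}$, $g_t(\cdot,\cdot,\xi):\mathbb R^n\times\mathbb R^n\to\mathbb R^p$, and let the matrices $A_t,B_t$ and vectors $b_t$ be functions of $\xi_t$. Put $X_t(x,\xi_t)=\{y\in\mathcal X_t: g_t(x,y,\xi_t)\le 0,\ A_ty+B_tx=b_t\}$. Consider $$\inf_{x_1\in X_1(x_0,\xi_1)} f_1(x_0,x_1,\xi_1)+\mathbb E_{|\mathcal F_1}\Big(\inf_{x_2\in X_2(x_1,\xi_2)} f_2(x_1,x_2,\xi_2)+\dots+\mathbb E_{|\mathcal F_{T-1}}\Big(\inf_{x_T\in X_T(x_{T-1},\xi_T)} f_T(x_{T-1},x_T,\xi_T)\Big)\cdots\Big)\tag{P}$$ with $\mathcal F_t=\sigma(\xi_1,\dots,\xi_t)$. Set $\mathcal Q_{T+1}\equiv0$, and, for $t=T,\dots,1$, $\mathfrak Q_t(x,\xi)=\inf\{f_t(x,y,\xi)+\mathcal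 Q_{t+1}(y):y\in X_t(x,\xi)\}$, $\mathcal Q_t(x)=\mathbb E[\mathfrak Q_t(x,\xi_t)]$ (so $\mathcal Q_1(x_0)=\mathfrak Q_1(x_0,\xi_1)$). **Assumptions.** (H1) $\xi_1,\dots,\xi_T$ are independent random vectors in $\mathbb R^K$, $\xi_t$ has finite support $\Theta_t$ (each point has positive probability), and $\xi_1$ is deterministic. (H2) For $t=1,\dots,T$: $\mathcal X_t$ is nonempty, convex, compact; $f_t(x,y,\cdot)$ is measurable; for all $z\in\Theta_t$, $f_t(\cdot,\cdot,z)$ is proper, convex, lower semicontinuous, and the components of $g_t(\cdot,\cdot,z)$ are convex and lower semicontinuous; there is $\varepsilon>0$ such that for all $z\in\Theta_t$ and all $x\in\mathcal X_{t-1}+\varepsilon\mathbb B_n$ ($\mathbb B_n$ the closed unit ball), $f_t(x,\cdot,z)$ is finite on $\mathcal X_t$ and $X_t(x,z)\neq\emptyset$; if $t\ge2$, for all $z\in\Theta_t$ there is $(\bar x,\bar y)\in(\mathcal X_{t-1}\times\mathrm{ri}\,\mathcal X_t)\cap\mathrm{ri}\{g_t(\cdot,\cdot,z)\le0\}$ with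 $\bar y\in X_t(\bar x,z)$. (H3) The realizations $\xi^k_t$ sampled at the iterations $k\ge1$ satisfy, for $2\le t\le T$ and $z\in\Theta_t$, $\mathbb P(\xi_t^k=z)=\mathbb P(\xi_t=z)>0$, and $\xi_t^k$ is independent of $\sigma(\xi_r^j\,(2\le r\le T,\,j<k),\ \xi_2^k,\dots,\xi_{t-1}^k)$; also $\xi_1^k=\xi_1$ and every sampled path has $\xi_t^k\in\Theta_t$. **Scenario tree.** A node $m$ of stage $t$ is a history $\xi_{[m]}=(z_1,\dots,z_t)$ with $z_i\in\Theta_i$; its last entry is $\xi_m$, $n_0$ is the root (stage $0$), $n_1$ its only child, $\mathcal P(m)$ the parent of $m$, $C(m)$ the set of its children, $p_m=\mathbb P(\xi_t=\xi_m)$, and $n_t^k$ is the node with history $(\xi_1^k,\dots,\xi_t^k)$ ($n_0^k=n_0$). **SREDA.** Given are $\lambda_{t,k}\ge0$ with $\lambda_{t,1}=0$, and functions $\mathcal Q_t^0:\mathcal X_{t-1}\to\mathbb R\cup\{-\infty\}$ with $\mathcal Q^0_t\le\mathcal Q_t$ on $\mathcal X_{t-1}$ ($2\le t\le T$); $\mathcal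 Q_{T+1}^k\equiv0$ and $x_{n_0}^k=x_0$ for all $k$. Let $$\bar F_t^{k-1}(x,y,c,\xi)=f_t(x,y,\xi)+\mathcal Q_{t+1}^{k-1}(y)+\lambda_{t,k}\|y-c\|^2,\qquad \underline{\mathfrak Q}_t^k(x,\xi)=\inf\{f_t(x,y,\xi)+\mathcal Q_{t+1}^k(y):y\in X_t(x,\xi)\}.$$ Iteration $k=1,2,\dots$: (forward) choose prox-centers $x_t^{P,k}\in\mathcal X_t$ and, for $t=1,\dots,T$, every node $n$ of stage $t-1$ and every $m\in C(n)$, choose a minimizer $x_m^k$ of $\bar F_t^{k-1}(x_n^k,\cdot,x_t^{P,k},\xi_m)$ over $X_t(x_n^k,\xi_m)$; (backward) for $t=T,\dots,2$, with $n=n_{t-1}^k$, choose subgradients $\pi_m^k$ of $\underline{\mathfrak Q}_t^k(\cdot,\xi_m):\mathbb R^n\to[-\infty,+\infty]$ at $x_n^k$ for $m\in C(n)$ and set $$\mathcal Q_t^k=\max\Big\{\mathcal Q_t^{k-1},\ \sum_{m\in C(n)}p_m\big(\underline{\mathfrak Q}_t^k(x_n^k,\xi_m)+\langle\pi_m^k,\cdot-x_n^k\rangle\big)\Big\}.$$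 The algorithm does not look ahead: prox-centers and decisions at iteration $k$ are functions of the samples of iterations $1,\dots,k-1$, and the $\pi^k_m$ are functions of the samples of iterations $1,\dots,k$. **SDDP-REG** is the variant that in iteration $k$ computes $x_m^k$ only for the children $m$ of $n_0^k,\dots,n_{T-1}^k$. **Theorem.** Let (H1), (H2), (H3) hold, let $\lambda_{T,k}=0$ for all $k\ge1$ and $\lim_{k\to\infty}\lambda_{t,k}=0$ for $t=1,\dots,T-1$. Then $\mathcal Q_1(x_0)$ is the optimal value of (P), and for SREDA: (i) almost surely, for $t=2,\dots,T+1$ and every node $n$ of stage $t-1$, $\lim_{k\to\infty}\big(\mathcal Q_t(x_n^k)-\mathcal Q_t^k(x_n^k)\big)=0$; (ii) almost surely, $\lim_{k}\bar F_1^{k-1}(x_0,x_{n_1}^k,x_1^{P,k},\xi_1)=\lim_{k}\underline{\mathfrak Q}_1^k(x_0,\xi_1)=\mathcal Q_1(x_0)$; and, almost surely, for every accumulation point $(x_n^*)_n$ of the sequence $((x_n^k)_n)_k$ ($n$ running over all nodes), the policy $x_t(\xi_1,\dots,\xi_t)=x_m^*$, where $\xi_{[m]}=(\xi_1,\dots,\xi_t)$,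 is an optimal solution of (P): it is feasible, attains every infimum in (P), and minimizes $\mathbb E\sum_{t=1}^T f_t(x_{t-1},x_t,\xi_t)$ over all feasible policies, with minimum $\mathcal Q_1(x_0)$. For SDDP-REG: almost surely, for $t=2,\dots,T+1$ and every node $n$ of stage $t-1$, the set $\mathcal S_{\mathcal P(n)}$ of iterations $k\ge1$ whose sampled scenario passes through the parent of $n$ is infinite, and $\mathcal Q_t(x_n^k)-\mathcal Q_t^k(x_n^k)\to0$ as $k\to\infty$, $k\in\mathcal S_{\mathcal P(n)}$; and almost surely both limits in the first part of (ii) hold. -/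

import Mathlib

open MeasureTheory ProbabilityTheory Filter Topology
open scoped Pointwise ENNReal

noncomputable section

namespace SREDA

/-- The decision space `ℝⁿ` with the Euclidean norm; noise vectors live in `Vec K = ℝᴷ`. -/
abbrev Vec (n : ℕ) : Type := EuclideanSpace ℝ (Fin n)

/-- The data of a `T`-stage problem: `n` decision variables per stage, noise in `ℝᴷ`, `p` inequality
and `q` equality constraints per stage. Stages are `1, …, T`; other indices are never used.
The random data `A_t, B_t, b_t` are functions (e.g. blocks of coordinates) of the noise vector. -/
structure Problem (n K p q : ℕ) where
  T : ℕ
  x₀ : Vec n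
  X : ℕ → Set (Vec n)
  f : ℕ → Vec n → Vec n → Vec K → EReal
  g : ℕ → Vec n → Vec n → Vec K → Fin p → ℝ
  A : ℕ → Vec K → Matrix (Fin q) (Fin n) ℝ
  B : ℕ → Vec K → Matrix (Fin q) (Fin n) ℝ
  b : ℕ → Vec K → Fin q → ℝ

variable {n K p q : ℕ}

namespace Problem

/-- The sets `𝒳_t`, with `𝒳_0 = {x₀}`. -/
def stateSet (P : Problem n K p q) : ℕ → Set (Vec n)
  | 0 => {P.x₀}
  | t + 1 => P.X (t + 1)

/-- The feasible set `X_t(x, z)`. -/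
def feas (P : Problem n K p q) (t : ℕ) (x : Vec n) (z : Vec K) : Set (Vec n) :=
  {y | y ∈ P.X t ∧ (∀ i, P.g t x y z i ≤ 0) ∧
    (P.A t z).mulVec y.ofLp + (P.B t z).mulVec x.ofLp = P.b t z}

/-- `inf { f_t(x, y, z) + V(y) : y ∈ X_t(x, z) }` for a given function `V` of the next state. -/
def stageValue (P : Problem n K p q) (t : ℕ) (V : Vec n → EReal) (x : Vec n) (z : Vec K) : EReal :=
  ⨅ y ∈ P.feas t x z, P.f t x y z + V y

/-- Recourse function with `r` stages to go. -/
def recourseAux (P : Problem n K p q) (Θ : ℕ → Finset (Vec K)) (pr : ℕ → Vec K → ℝ) :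
    ℕ → Vec n → EReal
  | 0 => fun _ => 0
  | r + 1 => fun x => ∑ z ∈ Θ (P.T - r), (pr (P.T - r) z : EReal) *
      P.stageValue (P.T - r) (recourseAux P Θ pr r) x z

/-- The recourse functions `𝒬_t` : `𝒬_{T+1} = 0` and, for `t ≤ T`,
`𝒬_t(x) = ∑_{z ∈ Θ_t} P(ξ_t = z) inf { f_t(x,y,z) + 𝒬_{t+1}(y) : y ∈ X_t(x,z) }`;
here `pr t z` is the probability of the realization `z` at stage `t`. -/
def recourse (P : Problem n K p q) (Θ : ℕ → Finset (Vec K)) (pr : ℕ → Vec K → ℝ) (t : ℕ) :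
    Vec n → EReal :=
  P.recourseAux Θ pr (P.T + 1 - t)

theorem recourse_terminal (P : Problem n K p q) (Θ : ℕ → Finset (Vec K)) (pr : ℕ → Vec K → ℝ) :
    P.recourse Θ pr (P.T + 1) = fun _ => 0 := by
  simp [recourse, recourseAux]

theorem recourse_eq (P : Problem n K p q) (Θ : ℕ → Finset (Vec K)) (pr : ℕ → Vec K → ℝ)
    {t : ℕ} (ht : t ≤ P.T) (x : Vec n) :
    P.recourse Θ pr t x =
      ∑ z ∈ Θ t, (pr t z : EReal) * P.stageValue t (P.recourse Θ pr (t + 1)) x z := by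
  have h1 : P.T + 1 - t = (P.T - t) + 1 := by omega
  have h2 : P.T - (P.T - t) = t := by omega
  have h3 : P.T + 1 - (t + 1) = P.T - t := by omega
  simp only [recourse, h1, h3, recourseAux, h2]

end Problem

/-! ### Noise process and scenario tree -/

/-- The history `[s_t, …, s_1]` (latest value first) of a path `s`. -/
def history {α : Type*} (s : ℕ → α) : ℕ → List α
  | 0 => []
  | t + 1 => s (t + 1) :: history s t

open Classical in
/-- The nodes of stage `t` of the scenario tree. A node is identified with the history
`[z_t, …, z_1]` of realizations leading to it (latest first), so `[]` is the root `n_0`, and the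
children of a node `m` of stage `t` are the lists `z :: m` with `z ∈ Θ_{t+1}`. -/
def nodes (Θ : ℕ → Finset (Vec K)) : ℕ → Finset (List (Vec K))
  | 0 => {[]}
  | t + 1 => (Θ (t + 1) ×ˢ nodes Θ t).image fun a => a.1 :: a.2

/-- The set of all nodes of the scenario tree with stages `0, …, T`. -/
def treeNodes (Θ : ℕ → Finset (Vec K)) (T : ℕ) : Set (List (Vec K)) :=
  {m | ∃ t ≤ T, m ∈ nodes Θ t}

variable {Ω : Type*} [MeasurableSpace Ω]

/-- `P(ξ_t = z)`. -/
def stageProb (μ : Measure Ω) (ξ : ℕ → Ω → Vec K) (t : ℕ) (z : Vec K) : ℝ :=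
  μ.real {ω | ξ t ω = z}

/-- The event that the process follows the history (node) `m`. -/
def nodeEvent (ξ : ℕ → Ω → Vec K) (m : List (Vec K)) : Set Ω :=
  {ω | history (fun t => ξ t ω) m.length = m}

/-- The conditional probability `P(ξ_{t+1} = z | (ξ_1, …, ξ_t) = m)` for a history `m` of length
`t`. -/
def transProb (μ : Measure Ω) (ξ : ℕ → Ω → Vec K) (m : List (Vec K)) (z : Vec K) : ℝ :=
  (cond μ (nodeEvent ξ m)).real {ω | ξ (m.length + 1) ω = z}

/-! ### Assumptions -/

/-- (H1): `ξ_1, …, ξ_T` are independent, `ξ_t` has the finite support `Θ_t`, and `ξ_1` is the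
deterministic vector `ξ₁`. -/
structure H1 (T : ℕ) (μ : Measure Ω) (ξ : ℕ → Ω → Vec K) (Θ : ℕ → Finset (Vec K))
    (ξ₁ : Vec K) : Prop where
  measurable : ∀ t, 1 ≤ t → t ≤ T → Measurable (ξ t)
  indep : iIndepFun (fun t : Set.Icc 1 T => ξ t) μ
  mem_support : ∀ t, 1 ≤ t → t ≤ T → ∀ᵐ ω ∂μ, ξ t ω ∈ Θ t
  support_pos : ∀ t, 1 ≤ t → t ≤ T → ∀ z ∈ Θ t, 0 < stageProb μ ξ t z
  first : Θ 1 = {ξ₁}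

/-- (H2) at stage `t ≥ 1`. -/
structure H2 (P : Problem n K p q) (Θ : ℕ → Finset (Vec K)) (t : ℕ) : Prop where
  X_nonempty : (P.X t).Nonempty
  X_convex : Convex ℝ (P.X t)
  X_compact : IsCompact (P.X t)
  f_measurable : ∀ x y, Measurable (P.f t x y)
  f_ne_bot : ∀ z ∈ Θ t, ∀ x y, P.f t x y z ≠ ⊥
  f_proper : ∀ z ∈ Θ t, ∃ x y, P.f t x y z ≠ ⊤
  f_convex : ∀ z ∈ Θ t, Convex ℝ {a : (Vec n × Vec n) × ℝ | P.f t a.1.1 a.1.2 z ≤ (a.2 : EReal)}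
  f_lsc : ∀ z ∈ Θ t, LowerSemicontinuous fun a : Vec n × Vec n => P.f t a.1 a.2 z
  g_convex : ∀ z ∈ Θ t, ∀ i, ConvexOn ℝ Set.univ fun a : Vec n × Vec n => P.g t a.1 a.2 z i
  g_lsc : ∀ z ∈ Θ t, ∀ i, LowerSemicontinuous fun a : Vec n × Vec n => P.g t a.1 a.2 z i
  recourse : ∃ ε : ℝ, 0 < ε ∧ ∀ z ∈ Θ t,
    ∀ x ∈ P.stateSet (t - 1) + Metric.closedBall (0 : Vec n) ε,
      (∀ y ∈ P.X t, P.f t x y z ≠ ⊤) ∧ (P.feas t x z).Nonempty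
  slater : 2 ≤ t → ∀ z ∈ Θ t, ∃ x ∈ P.X (t - 1), ∃ y ∈ intrinsicInterior ℝ (P.X t),
    (x, y) ∈ intrinsicInterior ℝ {a : Vec n × Vec n | ∀ i, P.g t a.1 a.2 z i ≤ 0} ∧
      y ∈ P.feas t x z

/-- (H3): `s k t` is the realization `ξ_t^k` sampled at iteration `k ≥ 1` for stage `t`. Every
sampled path is a path of the scenario tree, `ξ_t^k` has the law of `ξ_t`, and for `t ≥ 2` it is
independent of the σ-algebra generated by `ξ_r^j`, `2 ≤ r ≤ T`, `1 ≤ j < k`, and by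
`ξ_2^k, …, ξ_{t-1}^k`. -/
structure H3 (T : ℕ) (μ : Measure Ω) (ξ : ℕ → Ω → Vec K) (Θ : ℕ → Finset (Vec K))
    (s : ℕ → ℕ → Ω → Vec K) : Prop where
  mem_support : ∀ k t, 1 ≤ k → 1 ≤ t → t ≤ T → ∀ ω, s k t ω ∈ Θ t
  measurable : ∀ k t, 1 ≤ k → 2 ≤ t → t ≤ T → Measurable (s k t)
  law : ∀ k t, 1 ≤ k → 2 ≤ t → t ≤ T → ∀ z ∈ Θ t,
    μ.real {ω | s k t ω = z} = stageProb μ ξ t z ∧ 0 < stageProb μ ξ t z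
  indep : ∀ k t, 1 ≤ k → 2 ≤ t → t ≤ T →
    Indep (MeasurableSpace.comap (s k t) inferInstance)
      (⨆ (j : ℕ) (r : ℕ) (_ : 1 ≤ j ∧ 2 ≤ r ∧ r ≤ T ∧ (j < k ∨ (j = k ∧ r < t))),
        MeasurableSpace.comap (s j r) inferInstance) μ

/-! ### The multistage problem -/

/-- The nested multistage problem with `r` stages to go after the history `m`:
`E[ inf_{y ∈ X_t(x, ξ_t)} f_t(x, y, ξ_t) + E[ inf … ] | (ξ_1, …, ξ_{t-1}) = m ]`, where `x` is the
current state and `t - 1` the length of `m`. -/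
def nestedValue (P : Problem n K p q) (μ : Measure Ω) (ξ : ℕ → Ω → Vec K)
    (Θ : ℕ → Finset (Vec K)) : ℕ → List (Vec K) → Vec n → EReal
  | 0, _, _ => 0
  | r + 1, m, x => ∑ z ∈ Θ (m.length + 1), (transProb μ ξ m z : EReal) *
      P.stageValue (m.length + 1) (nestedValue P μ ξ Θ r (z :: m)) x z

/-- A policy assigns to every history `(ξ_1, …, ξ_t)` the decision of stage `t` (and `x₀` to the
empty history). It is feasible if all constraints hold at every node. -/
structure IsFeasiblePolicy (P : Problem n K p q) (Θ : ℕ → Finset (Vec K))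
    (u : List (Vec K) → Vec n) : Prop where
  root : u [] = P.x₀
  feas : ∀ t < P.T, ∀ m ∈ nodes Θ t, ∀ z ∈ Θ (t + 1), u (z :: m) ∈ P.feas (t + 1) (u m) z

/-- The expected total cost `E[∑_{t=1}^T f_t(x_{t-1}, x_t, ξ_t)]` of a policy. -/
def policyCost (P : Problem n K p q) (μ : Measure Ω) (ξ : ℕ → Ω → Vec K)
    (Θ : ℕ → Finset (Vec K)) (u : List (Vec K) → Vec n) : EReal :=
  ∑ t ∈ Finset.range P.T, ∑ m ∈ nodes Θ t, ∑ z ∈ Θ (t + 1),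
    (μ.real (nodeEvent ξ (z :: m)) : EReal) * P.f (t + 1) (u m) (u (z :: m)) z

/-- Optimal solutions of the multistage problem: feasible policies which attain every infimum of
the nested formulation and have the smallest expected total cost of all feasible policies. -/
structure IsOptimalPolicy (P : Problem n K p q) (μ : Measure Ω) (ξ : ℕ → Ω → Vec K)
    (Θ : ℕ → Finset (Vec K)) (u : List (Vec K) → Vec n) : Prop where
  feasible : IsFeasiblePolicy P Θ u
  attains : ∀ t < P.T, ∀ m ∈ nodes Θ t, ∀ z ∈ Θ (t + 1),
    P.f (t + 1) (u m) (u (z :: m)) z + nestedValue P μ ξ Θ (P.T - (t + 1)) (z :: m) (u (z :: m)) =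
      P.stageValue (t + 1) (nestedValue P μ ξ Θ (P.T - (t + 1)) (z :: m)) (u m) z
  minimal : ∀ v, IsFeasiblePolicy P Θ v → policyCost P μ ξ Θ u ≤ policyCost P μ ξ Θ v

/-! ### The algorithms -/

/-- `c ∈ ∂φ(x)` for an extended-real-valued function on `ℝⁿ`. -/
def IsSubgradient (φ : Vec n → EReal) (x c : Vec n) : Prop :=
  ∀ y, φ x + ((inner ℝ c (y - x) : ℝ) : EReal) ≤ φ y

/-- The regularized objective
`F̄_t(x, y, c, z) = f_t(x, y, z) + V(y) + l ‖y - c‖²` with prox-center `c` and penalty `l`. -/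
def regObj (P : Problem n K p q) (t : ℕ) (V : Vec n → EReal) (l : ℝ) (c x y : Vec n)
    (z : Vec K) : EReal :=
  P.f t x y z + V y + ((l * ‖y - c‖ ^ 2 : ℝ) : EReal)

/-- Everything computed by the algorithm along one sequence of sampled scenarios:
`x k m` is the decision `x_m^k`, `prox k t` the prox-center `x_t^{P,k}`, `sub k t z` the
subgradient `π_m^k` for the child node `m` of `n_{t-1}^k` with realization `z`, and `Q k t` the
approximate recourse function `𝒬_t^k`. Iterations are numbered `1, 2, …`; index `0` is
only used for the initial functions `𝒬_t^0`. -/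
structure Iterates (n K : ℕ) where
  x : ℕ → List (Vec K) → Vec n
  prox : ℕ → ℕ → Vec n
  sub : ℕ → ℕ → Vec K → Vec n
  Q : ℕ → ℕ → Vec n → EReal

/-- `R` is an execution of the algorithm, when `s k t` is the realization sampled at iteration `k`
for stage `t`, so that `n_t^k = history (s k) t`, and when the forward pass of iteration `k`
computes the decisions at the children of those nodes `m` with `visited k m`.
`pr t z` is the probability of the realization `z` at stage `t`, `lam t k` the penalty `λ_{t,k}`,
and `Q₀ t` the initial function `𝒬_t^0`. -/
structure IsExecution (P : Problem n K p q) (Θ : ℕ → Finset (Vec K)) (pr : ℕ → Vec K → ℝ)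
    (lam : ℕ → ℕ → ℝ) (Q₀ : ℕ → Vec n → EReal) (s : ℕ → ℕ → Vec K)
    (visited : ℕ → List (Vec K) → Prop) (R : Iterates n K) : Prop where
  init : ∀ t, 2 ≤ t → t ≤ P.T → R.Q 0 t = Q₀ t
  terminal : ∀ k, R.Q k (P.T + 1) = fun _ => 0
  root : ∀ k, R.x k [] = P.x₀
  prox_mem : ∀ k t, 1 ≤ t → t ≤ P.T → R.prox (k + 1) t ∈ P.X t
  /-- forward pass of iteration `k + 1` -/
  forward : ∀ k, ∀ t < P.T, ∀ m ∈ nodes Θ t, visited (k + 1) m → ∀ z ∈ Θ (t + 1),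
    R.x (k + 1) (z :: m) ∈ P.feas (t + 1) (R.x (k + 1) m) z ∧
    ∀ y ∈ P.feas (t + 1) (R.x (k + 1) m) z,
      regObj P (t + 1) (R.Q k (t + 2)) (lam (t + 1) (k + 1)) (R.prox (k + 1) (t + 1))
          (R.x (k + 1) m) (R.x (k + 1) (z :: m)) z ≤
        regObj P (t + 1) (R.Q k (t + 2)) (lam (t + 1) (k + 1)) (R.prox (k + 1) (t + 1))
          (R.x (k + 1) m) y z
  /-- backward pass of iteration `k + 1`: subgradients -/
  backward : ∀ k t, 2 ≤ t → t ≤ P.T → ∀ z ∈ Θ t,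
    IsSubgradient (fun x => P.stageValue t (R.Q (k + 1) (t + 1)) x z)
      (R.x (k + 1) (history (s (k + 1)) (t - 1))) (R.sub (k + 1) t z)
  /-- backward pass of iteration `k + 1`: the new cut
  `θ_t + ⟨β_t, x - x_{n_{t-1}}⟩` is added -/
  update : ∀ k t, 2 ≤ t → t ≤ P.T → ∀ x,
    R.Q (k + 1) t x = max (R.Q k t x)
      ((∑ z ∈ Θ t, (pr t z : EReal) * P.stageValue t (R.Q (k + 1) (t + 1))
          (R.x (k + 1) (history (s (k + 1)) (t - 1))) z) +
        ((inner ℝ (∑ z ∈ Θ t, pr t z • R.sub (k + 1) t z)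
          (x - R.x (k + 1) (history (s (k + 1)) (t - 1))) : ℝ) : EReal))

/-- The outcomes `ω, ω'` have the same samples at the iterations `1, …, k`. -/
def SameSamples (T : ℕ) (s : ℕ → ℕ → Ω → Vec K) (k : ℕ) (ω ω' : Ω) : Prop :=
  ∀ j t, 1 ≤ j → j ≤ k → 2 ≤ t → t ≤ T → s j t ω = s j t ω'

/-- The algorithm does not look ahead: decisions (where they are computed) and prox-centers of an
iteration are determined by the samples of the earlier iterations, and the subgradients by the
samples up to and including that iteration. -/
structure IsNonanticipative (T : ℕ) (Θ : ℕ → Finset (Vec K)) (s : ℕ → ℕ → Ω → Vec K)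
    (visited : Ω → ℕ → List (Vec K) → Prop) (R : Ω → Iterates n K) : Prop where
  x : ∀ k ω ω', SameSamples T s k ω ω' → ∀ t < T, ∀ m ∈ nodes Θ t,
    visited ω (k + 1) m → visited ω' (k + 1) m → ∀ z ∈ Θ (t + 1),
      (R ω).x (k + 1) (z :: m) = (R ω').x (k + 1) (z :: m)
  prox : ∀ k ω ω', SameSamples T s k ω ω' → ∀ t, 1 ≤ t → t ≤ T →
    (R ω).prox (k + 1) t = (R ω').prox (k + 1) t
  sub : ∀ k ω ω', SameSamples T s (k + 1) ω ω' → ∀ t, 2 ≤ t → t ≤ T → ∀ z ∈ Θ t,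
    (R ω).sub (k + 1) t z = (R ω').sub (k + 1) t z

/-- A (random) execution of the algorithm in which iteration `k` computes decisions at the children
of the nodes `m` with `visited ω k m`. -/
structure IsRandomExecution (P : Problem n K p q) (Θ : ℕ → Finset (Vec K)) (pr : ℕ → Vec K → ℝ)
    (lam : ℕ → ℕ → ℝ) (Q₀ : ℕ → Vec n → EReal) (s : ℕ → ℕ → Ω → Vec K)
    (visited : Ω → ℕ → List (Vec K) → Prop) (R : Ω → Iterates n K) : Prop where
  execution : ∀ ω, IsExecution P Θ pr lam Q₀ (fun k t => s k t ω) (visited ω) (R ω)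
  nonanticipative : IsNonanticipative P.T Θ s visited R

/-- SREDA computes decisions at all nodes of the tree. -/
def IsSREDA (P : Problem n K p q) (Θ : ℕ → Finset (Vec K)) (pr : ℕ → Vec K → ℝ)
    (lam : ℕ → ℕ → ℝ) (Q₀ : ℕ → Vec n → EReal) (s : ℕ → ℕ → Ω → Vec K)
    (R : Ω → Iterates n K) : Prop :=
  IsRandomExecution P Θ pr lam Q₀ s (fun _ _ _ => True) R

/-- The node `m` lies on the scenario sampled at iteration `k`. -/
def Sampled (s : ℕ → ℕ → Ω → Vec K) (ω : Ω) (k : ℕ) (m : List (Vec K)) : Prop :=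
  history (fun t => s k t ω) m.length = m

/-- SDDP-REG computes decisions only at the children of the nodes of the sampled scenario
(including the root). -/
def IsSDDPREG (P : Problem n K p q) (Θ : ℕ → Finset (Vec K)) (pr : ℕ → Vec K → ℝ)
    (lam : ℕ → ℕ → ℝ) (Q₀ : ℕ → Vec n → EReal) (s : ℕ → ℕ → Ω → Vec K)
    (R : Ω → Iterates n K) : Prop :=
  IsRandomExecution P Θ pr lam Q₀ s (Sampled s) R

end SREDA

end

open MeasureTheory ProbabilityTheory Filter Topology
open scoped Pointwise ENNReal

noncomputable section

namespace SREDA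

variable {n K p q : ℕ}

/-! The gap at a node is the amount by which $\mathcal Q_t^{k-1}$, the approximation available in
the forward pass of iteration $k$, falls short of $\mathcal Q_t$ at the decision $x_n^k$. Everything
follows once the gaps tend to zero at all computed decisions.

Regularity comes from recourse on a neighbourhood of the state set. There the true stage values are
finite and convex, hence continuous, and they bound the approximate ones from above. A subgradient
taken inside the state set therefore has room to move a fixed distance, so its norm is bounded
independently of $k$. The cuts are thus equi-Lipschitz and lie below $\mathcal Q_t$. By compactness,
a late cut exceeds the maximum of its predecessors by at most $\varepsilon$
(`exists_lt_add_of_equiLipschitz`): an iteration eventually changes the approximation arbitrarily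
little, uniformly on the state set.

The gaps vanish by backward induction on the stage (`IsExecution.eventually_gap_lt`). At a sampled
node the new cut is exact for the current approximate stage problems, so the error after the update
is at most the mean of the gaps at the children plus a vanishing penalty. Since late updates are
small, the gap before the update is small as well. Other nodes are handled by probability: whether
the gap at a node is large depends only on past samples, and the node is then sampled with a fixed
positive probability, independently of the past. Lévy's conditional Borel–Cantelli lemma shows that
a gap which is large infinitely often would be large infinitely often at iterations sampling the
node, which was excluded.

The first-stage limits follow by squeezing. For accumulation points, closed constraint graphs, lower
semicontinuous costs and continuous value functions carry the stage inequalities to the limit,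
giving the dynamic programming equations. Independence of the noise identifies these with the nested
problem, and a telescoping sum of expected costs proves optimality among all feasible policies. -/

theorem coe_real_sum {ι : Type*} (s : Finset ι) (f : ι → ℝ) :
    ((∑ i ∈ s, f i : ℝ) : EReal) = ∑ i ∈ s, (f i : EReal) := by
  classical
  induction s using Finset.induction_on with
  | empty => simp
  | insert a s ha ih => rw [Finset.sum_insert ha, Finset.sum_insert ha, EReal.coe_add, ih]

theorem Problem.stateSet_of_pos (P : Problem n K p q) {t : ℕ} (ht : 1 ≤ t) :
    P.stateSet t = P.X t := by
  obtain ⟨t, rfl⟩ : ∃ r, t = r + 1 := ⟨t - 1, by omega⟩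
  rfl

theorem Problem.feas_subset (P : Problem n K p q) (t : ℕ) (x : Vec n) (z : Vec K) :
    P.feas t x z ⊆ P.X t := fun _ hy => hy.1

/-- The minimal stage value is a lower bound of the objective. -/
theorem Problem.stageValue_le (P : Problem n K p q) {t : ℕ} (V : Vec n → EReal) {x y : Vec n}
    {z : Vec K} (hy : y ∈ P.feas t x z) : P.stageValue t V x z ≤ P.f t x y z + V y :=
  iInf₂_le y hy

theorem Problem.stageValue_mono (P : Problem n K p q) {t : ℕ} {V V' : Vec n → EReal}
    (h : ∀ y ∈ P.X t, V y ≤ V' y) (x : Vec n) (z : Vec K) :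
    P.stageValue t V x z ≤ P.stageValue t V' x z :=
  iInf₂_mono fun y hy => add_le_add_right (h y hy.1) _

/-! ### One-stage problems: compactness, convexity, attainment. -/

section Stage

variable {P : Problem n K p q} {Θ : ℕ → Finset (Vec K)} {t : ℕ}

/-- Sublevel sets of lower semicontinuous functions are closed. Closedness jointly in state and
decision is what makes limits of decisions feasible when the states move too. -/
theorem H2.isClosed_graph (h : H2 P Θ t) {z : Vec K} (hz : z ∈ Θ t) :
    IsClosed {a : Vec n × Vec n | a.2 ∈ P.feas t a.1 z} := by
  have h1 : IsClosed {a : Vec n × Vec n | a.2 ∈ P.X t} :=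
    h.X_compact.isClosed.preimage continuous_snd
  have h2 : IsClosed {a : Vec n × Vec n | ∀ i, P.g t a.1 a.2 z i ≤ 0} := by
    simp only [Set.ofPred_forall]
    exact isClosed_iInter fun i => (h.g_lsc z hz i).isClosed_preimage 0
  have h3 : IsClosed {a : Vec n × Vec n |
      (P.A t z).mulVec a.2.ofLp + (P.B t z).mulVec a.1.ofLp = P.b t z} := by
    refine isClosed_eq ?_ continuous_const
    have c1 : Continuous fun a : Vec n × Vec n => a.1.ofLp :=
      (PiLp.continuous_ofLp 2 _).comp continuous_fst
    have c2 : Continuous fun a : Vec n × Vec n => a.2.ofLp :=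
      (PiLp.continuous_ofLp 2 _).comp continuous_snd
    exact (continuous_const.matrix_mulVec c2).add (continuous_const.matrix_mulVec c1)
  exact h1.inter (h2.inter h3)

theorem H2.isCompact_feas (h : H2 P Θ t) {z : Vec K} (hz : z ∈ Θ t) (x : Vec n) :
    IsCompact (P.feas t x z) :=
  h.X_compact.of_isClosed_subset
    ((h.isClosed_graph hz).preimage (Continuous.prodMk_right x)) (P.feas_subset t x z)

theorem H2.convex_feas (h : H2 P Θ t) {z : Vec K} (hz : z ∈ Θ t) {x₁ x₂ y₁ y₂ : Vec n}
    (h₁ : y₁ ∈ P.feas t x₁ z) (h₂ : y₂ ∈ P.feas t x₂ z) {a b : ℝ} (ha : 0 ≤ a) (hb : 0 ≤ b)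
    (hab : a + b = 1) : a • y₁ + b • y₂ ∈ P.feas t (a • x₁ + b • x₂) z := by
  refine ⟨h.X_convex h₁.1 h₂.1 ha hb hab, fun i => ?_, ?_⟩
  · have := (h.g_convex z hz i).2 (Set.mem_univ (x₁, y₁)) (Set.mem_univ (x₂, y₂)) ha hb hab
    have e1 := mul_nonpos_of_nonneg_of_nonpos ha (h₁.2.1 i)
    have e2 := mul_nonpos_of_nonneg_of_nonpos hb (h₂.2.1 i)
    simp only [smul_eq_mul] at this
    exact this.trans (by linarith)
  · have e : a • P.b t z + b • P.b t z = P.b t z := by rw [← add_smul, hab, one_smul]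
    rw [← e]
    nth_rw 1 [← h₁.2.2]
    rw [← h₂.2.2]
    simp only [WithLp.ofLp_add, WithLp.ofLp_smul, Matrix.mulVec_add, Matrix.mulVec_smul, smul_add]
    abel

/-- Joint convexity of the stage cost, for finite values. -/
theorem H2.f_convex_le (h : H2 P Θ t) {z : Vec K} (hz : z ∈ Θ t) {x₁ x₂ y₁ y₂ : Vec n}
    {r₁ r₂ : ℝ} (h₁ : P.f t x₁ y₁ z ≤ r₁) (h₂ : P.f t x₂ y₂ z ≤ r₂) {a b : ℝ} (ha : 0 ≤ a)
    (hb : 0 ≤ b) (hab : a + b = 1) :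
    P.f t (a • x₁ + b • x₂) (a • y₁ + b • y₂) z ≤ ((a * r₁ + b * r₂ : ℝ) : EReal) :=
  h.f_convex z hz (x := ((x₁, y₁), r₁)) h₁ (y := ((x₂, y₂), r₂)) h₂ ha hb hab

/-- The infimum defining the stage value is attained. -/
theorem H2.exists_stageValue_eq (h : H2 P Θ t) {z : Vec K} (hz : z ∈ Θ t) {x : Vec n}
    (hx : (P.feas t x z).Nonempty) {V : Vec n → EReal} {W : Vec n → ℝ}
    (hW : ContinuousOn W (P.X t)) (hV : ∀ y ∈ P.X t, V y = W y) :
    ∃ y ∈ P.feas t x z, P.stageValue t V x z = P.f t x y z + W y := by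
  have hl : LowerSemicontinuousOn (fun y => P.f t x y z + (W y : EReal)) (P.feas t x z) := by
    refine LowerSemicontinuousOn.add' (f := fun y => P.f t x y z) (g := fun y => (W y : EReal))
      ?_ ?_ ?_
    · exact ((h.f_lsc z hz).comp (Continuous.prodMk_right x)).lowerSemicontinuousOn _
    · exact (continuous_coe_real_ereal.comp_continuousOn
        (hW.mono (P.feas_subset t x z))).lowerSemicontinuousOn
    -- Addition on `EReal` is discontinuous only at opposite infinities, which are excluded because
    -- `W` is real and the cost is never `⊥`.
    · exact fun y _ => EReal.continuousAt_add (.inr (EReal.coe_ne_bot _))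
        (.inl (h.f_ne_bot z hz x y))
  obtain ⟨y, hy, hmin⟩ := hl.exists_isMinOn hx (h.isCompact_feas hz x)
  refine ⟨y, hy, le_antisymm ?_ ?_⟩
  · rw [← hV y hy.1]; exact P.stageValue_le V hy
  · refine le_iInf₂ fun y' hy' => ?_
    rw [hV y' hy'.1]
    exact hmin hy'

/-- Convexity and finiteness of the stage value in a neighbourhood of the set of states. -/
theorem H2.exists_convexOn_stageValue (h : H2 P Θ t) (hconv : Convex ℝ (P.stateSet (t - 1)))
    {V : Vec n → EReal} {W : Vec n → ℝ} (hW : ContinuousOn W (P.X t))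
    (hWv : ConvexOn ℝ (P.X t) W) (hV : ∀ y ∈ P.X t, V y = W y) :
    ∃ δ : ℝ, 0 < δ ∧ ∀ z ∈ Θ t,
      ConvexOn ℝ (P.stateSet (t - 1) + Metric.ball 0 δ)
        (fun x => (P.stageValue t V x z).toReal) ∧
      ∀ x ∈ P.stateSet (t - 1) + Metric.ball (0 : Vec n) δ,
        P.stageValue t V x z = ((P.stageValue t V x z).toReal : EReal) := by
  obtain ⟨δ, hδ, hfin⟩ := h.recourse
  refine ⟨δ, hδ, fun z hz => ?_⟩
  have key : ∀ x ∈ P.stateSet (t - 1) + Metric.ball (0 : Vec n) δ, ∃ y ∈ P.feas t x z, ∃ r : ℝ,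
      P.f t x y z = r ∧ P.stageValue t V x z = ((r + W y : ℝ) : EReal) := by
    intro x hx
    obtain ⟨h1, h2⟩ := hfin z hz x (Set.add_subset_add_left Metric.ball_subset_closedBall hx)
    obtain ⟨y, hy, e⟩ := h.exists_stageValue_eq hz h2 hW hV
    have hr := EReal.coe_toReal (h1 y hy.1) (h.f_ne_bot z hz x y)
    refine ⟨y, hy, _, hr.symm, ?_⟩
    rw [e, EReal.coe_add, hr]
  refine ⟨⟨hconv.add (convex_ball _ _), ?_⟩, fun x hx => ?_⟩
  -- Partial minimization preserves convexity: the combination of two minimizers is feasible for the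
  -- combined state.
  · intro x₁ hx₁ x₂ hx₂ a b ha hb hab
    obtain ⟨y₁, hy₁, r₁, f₁, e₁⟩ := key x₁ hx₁
    obtain ⟨y₂, hy₂, r₂, f₂, e₂⟩ := key x₂ hx₂
    have hx := (hconv.add (convex_ball (0 : Vec n) δ)) hx₁ hx₂ ha hb hab
    obtain ⟨y, hy, r, f, e⟩ := key _ hx
    have h3 := P.stageValue_le V (h.convex_feas hz hy₁ hy₂ ha hb hab)
    have h4 := h.f_convex_le hz f₁.le f₂.le ha hb hab
    have h5 := hWv.2 hy₁.1 hy₂.1 ha hb hab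
    rw [hV _ (h.X_convex hy₁.1 hy₂.1 ha hb hab)] at h3
    have h6 := h3.trans (add_le_add h4 (EReal.coe_le_coe_iff.2 h5))
    rw [e, ← EReal.coe_add, EReal.coe_le_coe_iff] at h6
    simp only [e, e₁, e₂, EReal.toReal_coe, smul_eq_mul] at h6 ⊢
    linarith
  · obtain ⟨y, hy, r, f, e⟩ := key x hx
    rw [e, EReal.toReal_coe]

/-- The stage cost is bounded below on the relevant compact set. -/
theorem H2.exists_le_f (h : H2 P Θ t) (hc : IsCompact (P.stateSet (t - 1))) {z : Vec K}
    (hz : z ∈ Θ t) : ∃ r : ℝ, ∀ x ∈ P.stateSet (t - 1), ∀ y ∈ P.X t, (r : EReal) ≤ P.f t x y z := by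
  rcases (P.stateSet (t - 1)).eq_empty_or_nonempty with he | hne
  · exact ⟨0, by simp [he]⟩
  obtain ⟨a, -, ha⟩ := ((h.f_lsc z hz).lowerSemicontinuousOn _).exists_isMinOn
    (hne.prod h.X_nonempty) (hc.prod h.X_compact)
  obtain ⟨r, hr⟩ : ∃ r : ℝ, (r : EReal) ≤ P.f t a.1 a.2 z := by
    induction hfa : P.f t a.1 a.2 z with
    | bot => exact absurd hfa (h.f_ne_bot z hz _ _)
    | coe r => exact ⟨r, le_rfl⟩
    | top => exact ⟨0, le_top⟩
  exact ⟨r, fun x hx y hy => hr.trans (ha (Set.mk_mem_prod hx hy : (x, y) ∈ _))⟩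

theorem H2.f_ne_top (h : H2 P Θ t) {z : Vec K} (hz : z ∈ Θ t) {x y : Vec n}
    (hx : x ∈ P.stateSet (t - 1)) (hy : y ∈ P.X t) : P.f t x y z ≠ ⊤ := by
  obtain ⟨δ, hδ, hfin⟩ := h.recourse
  exact (hfin z hz x ⟨x, hx, 0, Metric.mem_closedBall_self hδ.le, add_zero x⟩).1 y hy

theorem H2.coe_f (h : H2 P Θ t) {z : Vec K} (hz : z ∈ Θ t) {x y : Vec n}
    (hx : x ∈ P.stateSet (t - 1)) (hy : y ∈ P.X t) :
    P.f t x y z = ((P.f t x y z).toReal : EReal) :=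
  (EReal.coe_toReal (h.f_ne_top hz hx hy) (h.f_ne_bot z hz x y)).symm

end Stage

/-! ### Regularity of the true recourse functions. -/

section Recourse

variable {P : Problem n K p q} {Θ : ℕ → Finset (Vec K)}

theorem isCompact_stateSet (h2 : ∀ t, 1 ≤ t → t ≤ P.T → H2 P Θ t) {t : ℕ} (ht : t ≤ P.T) :
    IsCompact (P.stateSet t) := by
  cases t with
  | zero => exact isCompact_singleton
  | succ t => exact (h2 (t + 1) (by omega) ht).X_compact

theorem convex_stateSet (h2 : ∀ t, 1 ≤ t → t ≤ P.T → H2 P Θ t) {t : ℕ} (ht : t ≤ P.T) :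
    Convex ℝ (P.stateSet t) := by
  cases t with
  | zero => exact convex_singleton _
  | succ t => exact (h2 (t + 1) (by omega) ht).X_convex

theorem subset_add_ball (s : Set (Vec n)) {δ : ℝ} (hδ : 0 < δ) : s ⊆ s + Metric.ball 0 δ :=
  fun x hx => ⟨x, hx, 0, Metric.mem_ball_self hδ, add_zero x⟩

/-- The recourse functions are finite, convex and continuous on the sets of states. -/
theorem recourse_regular (h2 : ∀ t, 1 ≤ t → t ≤ P.T → H2 P Θ t) {pr : ℕ → Vec K → ℝ}
    (hpr : ∀ t, 1 ≤ t → t ≤ P.T → ∀ z ∈ Θ t, 0 ≤ pr t z) {t : ℕ} (ht : 1 ≤ t)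
    (htT : t ≤ P.T + 1) :
    ContinuousOn (fun x => (P.recourse Θ pr t x).toReal) (P.stateSet (t - 1)) ∧
    ConvexOn ℝ (P.stateSet (t - 1)) (fun x => (P.recourse Θ pr t x).toReal) ∧
    ∀ x ∈ P.stateSet (t - 1), P.recourse Θ pr t x = ((P.recourse Θ pr t x).toReal : EReal) := by
  induction htT using Nat.decreasingInduction with
  | self =>
    simp only [P.recourse_terminal, EReal.toReal_zero, EReal.coe_zero, implies_true, and_true]
    exact ⟨continuousOn_const, convexOn_const _ (convex_stateSet h2 (by omega))⟩
  | of_succ t htT ih =>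
    obtain ⟨ih1, ih2, ih3⟩ := ih (by omega)
    rw [Nat.add_sub_cancel, P.stateSet_of_pos ht] at ih1 ih2 ih3
    obtain ⟨δ, hδ, hs⟩ := (h2 t ht (by omega)).exists_convexOn_stageValue
      (convex_stateSet h2 (by omega)) ih1 ih2 ih3
    have hsub := subset_add_ball (P.stateSet (t - 1)) hδ
    have e : ∀ x ∈ P.stateSet (t - 1), P.recourse Θ pr t x =
        ((∑ z ∈ Θ t, pr t z * (P.stageValue t (P.recourse Θ pr (t + 1)) x z).toReal : ℝ) :
          EReal) := by
      intro x hx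
      rw [P.recourse_eq Θ pr (by omega), coe_real_sum]
      refine Finset.sum_congr rfl fun z hz => ?_
      rw [EReal.coe_mul, ← (hs z hz).2 x (hsub hx)]
    have e' : ∀ x ∈ P.stateSet (t - 1), (P.recourse Θ pr t x).toReal =
        ∑ z ∈ Θ t, pr t z * (P.stageValue t (P.recourse Θ pr (t + 1)) x z).toReal := by
      intro x hx
      rw [e x hx, EReal.toReal_coe]
    -- Convex functions on open sets of a finite-dimensional space are continuous. The thickening
    -- makes the domain open, so continuity holds up to the boundary of the state set.
    have hopen : IsOpen (P.stateSet (t - 1) + Metric.ball (0 : Vec n) δ) :=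
      Metric.isOpen_ball.add_left
    refine ⟨?_, ?_, fun x hx => by rw [e' x hx, ← e x hx]⟩
    · refine ContinuousOn.congr ?_ e'
      exact continuousOn_finsetSum _ fun z hz =>
        continuousOn_const.mul (((hs z hz).1.continuousOn hopen).mono hsub)
    · refine ConvexOn.congr ?_ fun x hx => (e' x hx).symm
      have hc := convex_stateSet h2 (show t - 1 ≤ P.T by omega)
      refine ⟨hc, fun x hx y hy a b ha hb hab => ?_⟩
      simp only [smul_eq_mul, Finset.mul_sum, ← Finset.sum_add_distrib]
      refine Finset.sum_le_sum fun z hz => ?_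
      have := mul_le_mul_of_nonneg_left
        ((hs z hz).1.2 (hsub hx) (hsub hy) ha hb hab) (hpr t ht (by omega) z hz)
      simp only [smul_eq_mul] at this
      linarith

/-- The stage values of the dynamic programming equations are finite and continuous in a
neighbourhood of the set of states. -/
theorem stageValue_recourse_regular (h2 : ∀ t, 1 ≤ t → t ≤ P.T → H2 P Θ t) {pr : ℕ → Vec K → ℝ}
    (hpr : ∀ t, 1 ≤ t → t ≤ P.T → ∀ z ∈ Θ t, 0 ≤ pr t z) {t : ℕ} (ht : 1 ≤ t) (htT : t ≤ P.T) :
    ∃ δ : ℝ, 0 < δ ∧ ∀ z ∈ Θ t,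
      ContinuousOn (fun x => (P.stageValue t (P.recourse Θ pr (t + 1)) x z).toReal)
        (P.stateSet (t - 1) + Metric.ball 0 δ) ∧
      ∀ x ∈ P.stateSet (t - 1) + Metric.ball (0 : Vec n) δ,
        P.stageValue t (P.recourse Θ pr (t + 1)) x z =
          ((P.stageValue t (P.recourse Θ pr (t + 1)) x z).toReal : EReal) := by
  obtain ⟨h1, h3, h4⟩ := recourse_regular h2 hpr (t := t + 1) (by omega) (by omega)
  rw [Nat.add_sub_cancel, P.stateSet_of_pos ht] at h1 h3 h4
  obtain ⟨δ, hδ, hs⟩ := (h2 t ht htT).exists_convexOn_stageValue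
    (convex_stateSet h2 (by omega)) h1 h3 h4
  exact ⟨δ, hδ, fun z hz => ⟨(hs z hz).1.continuousOn Metric.isOpen_ball.add_left, (hs z hz).2⟩⟩

end Recourse

/-! ### Nodes of the scenario tree. -/

section Nodes

variable {Θ : ℕ → Finset (Vec K)}

theorem mem_nodes_succ {t : ℕ} {m : List (Vec K)} :
    m ∈ nodes Θ (t + 1) ↔ ∃ z ∈ Θ (t + 1), ∃ m' ∈ nodes Θ t, m = z :: m' := by
  simp only [nodes, Finset.mem_image, Finset.mem_product, Prod.exists]
  constructor
  · rintro ⟨z, m', ⟨hz, hm'⟩, rfl⟩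
    exact ⟨z, hz, m', hm', rfl⟩
  · rintro ⟨z, hz, m', hm', rfl⟩
    exact ⟨z, m', ⟨hz, hm'⟩, rfl⟩

theorem cons_mem_nodes {t : ℕ} {z : Vec K} {m : List (Vec K)} :
    z :: m ∈ nodes Θ (t + 1) ↔ z ∈ Θ (t + 1) ∧ m ∈ nodes Θ t := by
  rw [mem_nodes_succ]
  constructor
  · rintro ⟨z', hz, m', hm, h⟩
    obtain ⟨rfl, rfl⟩ := List.cons.inj h
    exact ⟨hz, hm⟩
  · exact fun h => ⟨z, h.1, m, h.2, rfl⟩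

theorem length_of_mem_nodes {t : ℕ} {m : List (Vec K)} (hm : m ∈ nodes Θ t) : m.length = t := by
  induction t generalizing m with
  | zero => simp_all [nodes]
  | succ t ih =>
    obtain ⟨z, -, m', hm', rfl⟩ := mem_nodes_succ.1 hm
    simp [ih hm']

theorem length_history {α : Type*} (s : ℕ → α) (t : ℕ) : (history s t).length = t := by
  induction t with
  | zero => rfl
  | succ t ih => simp [history, ih]

theorem history_mem_nodes {s : ℕ → Vec K} {t : ℕ} (h : ∀ i, 1 ≤ i → i ≤ t → s i ∈ Θ i) :
    history s t ∈ nodes Θ t := by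
  induction t with
  | zero => simp [history, nodes]
  | succ t ih =>
    exact cons_mem_nodes.2 ⟨h _ (by omega) le_rfl, ih fun i h1 h2 => h i h1 (by omega)⟩

theorem history_cons {α : Type*} {s : ℕ → α} {z : α} {m : List α} :
    history s (z :: m).length = z :: m ↔ s (m.length + 1) = z ∧ history s m.length = m := by
  simp [history]

end Nodes

/-! ### Bounds on approximations, subgradients and cuts. -/

section Execution

/-- The deterministic assumptions on problem, probabilities, penalties and initial functions. -/
structure Admissible (P : Problem n K p q) (Θ : ℕ → Finset (Vec K)) (pr : ℕ → Vec K → ℝ)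
    (lam : ℕ → ℕ → ℝ) (Q₀ : ℕ → Vec n → EReal) : Prop where
  h2 : ∀ t, 1 ≤ t → t ≤ P.T → H2 P Θ t
  pr_nonneg : ∀ t, 1 ≤ t → t ≤ P.T → ∀ z ∈ Θ t, 0 ≤ pr t z
  pr_sum : ∀ t, 1 ≤ t → t ≤ P.T → ∑ z ∈ Θ t, pr t z = 1
  lam_nonneg : ∀ t k, 1 ≤ t → t ≤ P.T → 1 ≤ k → 0 ≤ lam t k
  lam_lim : ∀ t, 1 ≤ t → t ≤ P.T → Tendsto (lam t) atTop (𝓝 0)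
  Q₀_le : ∀ t, 2 ≤ t → t ≤ P.T → ∀ x ∈ P.X (t - 1), Q₀ t x ≤ P.recourse Θ pr t x

/-- Sampled paths stay in the scenario tree, and the decisions at the children of the sampled
nodes are computed. -/
structure IsPath (P : Problem n K p q) (Θ : ℕ → Finset (Vec K)) (s : ℕ → ℕ → Vec K)
    (visited : ℕ → List (Vec K) → Prop) : Prop where
  mem_support : ∀ k t, 1 ≤ k → 1 ≤ t → t ≤ P.T → s k t ∈ Θ t
  visited_of_sampled : ∀ k m, history (s k) m.length = m → visited k m

variable {P : Problem n K p q} {Θ : ℕ → Finset (Vec K)} {pr : ℕ → Vec K → ℝ}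
  {lam : ℕ → ℕ → ℝ} {Q₀ : ℕ → Vec n → EReal} {s : ℕ → ℕ → Vec K}
  {visited : ℕ → List (Vec K) → Prop} {R : Iterates n K} {t : ℕ}

theorem Admissible.coe_recourse (h : Admissible P Θ pr lam Q₀) (ht : 1 ≤ t) (htT : t ≤ P.T + 1)
    {x : Vec n} (hx : x ∈ P.stateSet (t - 1)) :
    P.recourse Θ pr t x = ((P.recourse Θ pr t x).toReal : EReal) :=
  (recourse_regular h.h2 h.pr_nonneg ht htT).2.2 x hx

theorem Admissible.coe_stageValue (h : Admissible P Θ pr lam Q₀) (ht : 1 ≤ t) (htT : t ≤ P.T)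
    {z : Vec K} (hz : z ∈ Θ t) {x : Vec n} (hx : x ∈ P.stateSet (t - 1)) :
    P.stageValue t (P.recourse Θ pr (t + 1)) x z =
      ((P.stageValue t (P.recourse Θ pr (t + 1)) x z).toReal : EReal) := by
  obtain ⟨δ, hδ, hv⟩ := stageValue_recourse_regular h.h2 h.pr_nonneg ht htT
  exact (hv z hz).2 x (subset_add_ball _ hδ hx)

theorem Admissible.toReal_recourse (h : Admissible P Θ pr lam Q₀) (ht : 1 ≤ t) (htT : t ≤ P.T)
    {x : Vec n} (hx : x ∈ P.stateSet (t - 1)) :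
    (P.recourse Θ pr t x).toReal =
      ∑ z ∈ Θ t, pr t z * (P.stageValue t (P.recourse Θ pr (t + 1)) x z).toReal := by
  rw [P.recourse_eq Θ pr htT, ← EReal.toReal_coe (∑ z ∈ Θ t, _), coe_real_sum]
  congr 1
  refine Finset.sum_congr rfl fun z hz => ?_
  rw [EReal.coe_mul, ← h.coe_stageValue ht htT hz hx]

theorem IsExecution.x_mem (hR : IsExecution P Θ pr lam Q₀ s visited R) {k t : ℕ} (ht : t < P.T)
    {m : List (Vec K)} (hm : m ∈ nodes Θ t) (hv : visited (k + 1) m) {z : Vec K}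
    (hz : z ∈ Θ (t + 1)) : R.x (k + 1) (z :: m) ∈ P.stateSet (t + 1) :=
  (hR.forward k t ht m hm hv z hz).1.1

/-- The node of stage `t` sampled at an iteration. -/
theorem IsPath.sampled_mem_nodes (hs : IsPath P Θ s visited) {k t : ℕ} (ht : t ≤ P.T) :
    history (s (k + 1)) t ∈ nodes Θ t :=
  history_mem_nodes fun i h1 h2 => hs.mem_support _ i (by omega) h1 (by omega)

theorem IsPath.visited_history (hs : IsPath P Θ s visited) (k t : ℕ) :
    visited k (history (s k) t) :=
  hs.visited_of_sampled _ _ (by rw [length_history])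

theorem IsExecution.sampled_mem (hR : IsExecution P Θ pr lam Q₀ s visited R)
    (hs : IsPath P Θ s visited) {k t : ℕ} (ht : t ≤ P.T) :
    R.x (k + 1) (history (s (k + 1)) t) ∈ P.stateSet t := by
  cases t with
  | zero => exact hR.root _
  | succ t =>
    exact hR.x_mem (by omega) (hs.sampled_mem_nodes (by omega)) (hs.visited_history _ _)
      (hs.mem_support _ _ (by omega) (by omega) ht)

/-- The approximations `𝒬_t^k` are bounded above by `𝒬_t` and, from the first iteration on,
uniformly bounded below. -/
structure Bracketed (P : Problem n K p q) (Θ : ℕ → Finset (Vec K)) (pr : ℕ → Vec K → ℝ)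
    (R : Iterates n K) (t : ℕ) : Prop where
  le : ∀ k, ∀ x ∈ P.stateSet (t - 1), R.Q k t x ≤ P.recourse Θ pr t x
  ge : ∃ r : ℝ, ∀ k, ∀ x ∈ P.stateSet (t - 1), (r : EReal) ≤ R.Q (k + 1) t x

/-- The index starts at $1$ because the initial functions may take the value $-\infty$. -/
theorem Bracketed.coe_Q (hb : Bracketed P Θ pr R t) (h : Admissible P Θ pr lam Q₀)
    (ht : 1 ≤ t) (htT : t ≤ P.T + 1) (k : ℕ) {x : Vec n} (hx : x ∈ P.stateSet (t - 1)) :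
    R.Q (k + 1) t x = ((R.Q (k + 1) t x).toReal : EReal) := by
  obtain ⟨r, hr⟩ := hb.ge
  refine (EReal.coe_toReal (ne_top_of_le_ne_top ?_ (hb.le _ x hx))
    (ne_bot_of_le_ne_bot (EReal.coe_ne_bot r) (hr k x hx))).symm
  rw [(recourse_regular h.h2 h.pr_nonneg ht htT).2.2 x hx]
  exact EReal.coe_ne_top _

theorem Bracketed.stageValue_le (hb : Bracketed P Θ pr R (t + 1)) (ht : 1 ≤ t) (k : ℕ)
    (x : Vec n) (z : Vec K) :
    P.stageValue t (R.Q k (t + 1)) x z ≤ P.stageValue t (P.recourse Θ pr (t + 1)) x z :=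
  P.stageValue_mono (fun y hy => hb.le k y (by rwa [Nat.add_sub_cancel, P.stateSet_of_pos ht])) x z

/-- The bound does not depend on `k`, which is what makes the bound on subgradients uniform. -/
theorem Bracketed.exists_le_stageValue (hb : Bracketed P Θ pr R (t + 1))
    (h : Admissible P Θ pr lam Q₀) (ht : 1 ≤ t) (htT : t ≤ P.T) {z : Vec K} (hz : z ∈ Θ t) :
    ∃ r : ℝ, ∀ k, ∀ x ∈ P.stateSet (t - 1),
      (r : EReal) ≤ P.stageValue t (R.Q (k + 1) (t + 1)) x z := by
  obtain ⟨r₁, h₁⟩ := (h.h2 t ht htT).exists_le_f (isCompact_stateSet h.h2 (by omega)) hz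
  obtain ⟨r₂, h₂⟩ := hb.ge
  refine ⟨r₁ + r₂, fun k x hx => le_iInf₂ fun y hy => ?_⟩
  rw [EReal.coe_add]
  exact add_le_add (h₁ x hx y hy.1)
    (h₂ k y (by rw [Nat.add_sub_cancel, P.stateSet_of_pos ht]; exact hy.1))

theorem Bracketed.coe_stageValue (hb : Bracketed P Θ pr R (t + 1))
    (h : Admissible P Θ pr lam Q₀) (ht : 1 ≤ t) (htT : t ≤ P.T) {z : Vec K} (hz : z ∈ Θ t)
    (k : ℕ) {x : Vec n} (hx : x ∈ P.stateSet (t - 1)) :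
    P.stageValue t (R.Q (k + 1) (t + 1)) x z =
      ((P.stageValue t (R.Q (k + 1) (t + 1)) x z).toReal : EReal) := by
  obtain ⟨r, hr⟩ := hb.exists_le_stageValue h ht htT hz
  refine (EReal.coe_toReal (ne_top_of_le_ne_top ?_ (hb.stageValue_le ht _ x z))
    (ne_bot_of_le_ne_bot (EReal.coe_ne_bot r) (hr k x hx))).symm
  rw [h.coe_stageValue ht htT hz hx]
  exact EReal.coe_ne_top _

/-- The subgradients computed in the backward passes are uniformly bounded. -/
theorem IsExecution.exists_norm_sub_le (hR : IsExecution P Θ pr lam Q₀ s visited R)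
    (hs : IsPath P Θ s visited) (h : Admissible P Θ pr lam Q₀) {t : ℕ} (ht : 2 ≤ t)
    (htT : t ≤ P.T) (hb : Bracketed P Θ pr R (t + 1)) {z : Vec K} (hz : z ∈ Θ t) :
    ∃ B : ℝ, ∀ k, ‖R.sub (k + 1) t z‖ ≤ B := by
  obtain ⟨r, hr⟩ := hb.exists_le_stageValue h (by omega) htT hz
  obtain ⟨δ, hδ, hv⟩ := stageValue_recourse_regular h.h2 h.pr_nonneg (show 1 ≤ t by omega) htT
  obtain ⟨hvc, hve⟩ := hv z hz
  have hsub : P.stateSet (t - 1) + Metric.closedBall (0 : Vec n) (δ / 2) ⊆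
      P.stateSet (t - 1) + Metric.ball (0 : Vec n) δ :=
    Set.add_subset_add_left (Metric.closedBall_subset_ball (by linarith))
  -- Halving the radius gives a compact set inside the open one, so the true stage value has an
  -- upper bound `M` there.
  have hK : IsCompact (P.stateSet (t - 1) + Metric.closedBall (0 : Vec n) (δ / 2)) :=
    (isCompact_stateSet h.h2 (by omega)).add (isCompact_closedBall _ _)
  obtain ⟨M, hM⟩ := hK.bddAbove_image (hvc.mono hsub)
  -- A step of length $\delta/2$ along the subgradient raises the minorant, at least `r` at the base
  -- point, by $\frac{\delta}{2}\|c\|$, and the result cannot exceed `M`.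
  refine ⟨(M - r) / (δ / 2), fun k => ?_⟩
  set x := R.x (k + 1) (history (s (k + 1)) (t - 1)) with hx
  set c := R.sub (k + 1) t z
  have hxm : x ∈ P.stateSet (t - 1) := hR.sampled_mem hs (by omega)
  -- For `c = 0` the inverse is zero by convention and `d = 0`, which the computations below allow.
  set d : Vec n := (δ / 2 * ‖c‖⁻¹) • c with hd
  have hdn : ‖d‖ ≤ δ / 2 := by
    rw [hd, norm_smul, norm_mul, norm_inv, norm_norm, Real.norm_of_nonneg (by linarith), mul_assoc]
    exact mul_le_of_le_one_right (by linarith) (by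
      rcases eq_or_ne ‖c‖ 0 with h0 | h0
      · simp [h0]
      · rw [inv_mul_cancel₀ h0])
  have hcd : inner ℝ c d = δ / 2 * ‖c‖ := by
    rw [hd, inner_smul_right, real_inner_self_eq_norm_sq]
    rcases eq_or_ne ‖c‖ 0 with h0 | h0
    · simp [h0]
    · field_simp
  have hxd : x + d ∈ P.stateSet (t - 1) + Metric.closedBall (0 : Vec n) (δ / 2) :=
    Set.add_mem_add hxm (by simpa using hdn)
  have h1 := hR.backward k t ht htT z hz (x + d)
  simp only [← hx, add_sub_cancel_left] at h1
  have h2 := (add_le_add_left (hr k x hxm) _).trans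
    (h1.trans (hb.stageValue_le (by omega) _ _ _))
  rw [hve _ (hsub hxd), ← EReal.coe_add, EReal.coe_le_coe_iff] at h2
  have h3 := hM (Set.mem_image_of_mem _ hxd)
  beta_reduce at h3
  rw [le_div_iff₀ (by linarith)]
  have : inner ℝ c d ≤ M - r := by linarith
  linarith

/-- The cuts computed in the backward passes are equi-Lipschitz and valid. -/
theorem IsExecution.exists_cuts (hR : IsExecution P Θ pr lam Q₀ s visited R)
    (hs : IsPath P Θ s visited) (h : Admissible P Θ pr lam Q₀) {t : ℕ} (ht : 2 ≤ t)
    (htT : t ≤ P.T) (hb : Bracketed P Θ pr R (t + 1)) :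
    ∃ (c : ℕ → Vec n → ℝ) (L : ℝ),
      (∀ k x, R.Q (k + 1) t x = max (R.Q k t x) (c k x)) ∧
      (∀ k x y, c k x ≤ c k y + L * ‖x - y‖) ∧
      (∀ k, ∀ x ∈ P.stateSet (t - 1), c k x ≤ (P.recourse Θ pr t x).toReal) ∧
      ∀ k, c k (R.x (k + 1) (history (s (k + 1)) (t - 1))) =
        ∑ z ∈ Θ t, pr t z * (P.stageValue t (R.Q (k + 1) (t + 1))
          (R.x (k + 1) (history (s (k + 1)) (t - 1))) z).toReal := by
  have hxm : ∀ k, R.x (k + 1) (history (s (k + 1)) (t - 1)) ∈ P.stateSet (t - 1) :=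
    fun k => hR.sampled_mem hs (by omega)
  have hcoe : ∀ k, ∀ z ∈ Θ t, _ := fun k z hz =>
    hb.coe_stageValue h (by omega) htT hz k (hxm k)
  have hB : ∀ z, ∃ B : ℝ, z ∈ Θ t → ∀ k, ‖R.sub (k + 1) t z‖ ≤ B := fun z => by
    by_cases hz : z ∈ Θ t
    · obtain ⟨B, hB⟩ := hR.exists_norm_sub_le hs h ht htT hb hz
      exact ⟨B, fun _ => hB⟩
    · exact ⟨0, fun h => absurd h hz⟩
  choose B hB using hB
  refine ⟨fun k x => (∑ z ∈ Θ t, pr t z * (P.stageValue t (R.Q (k + 1) (t + 1))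
      (R.x (k + 1) (history (s (k + 1)) (t - 1))) z).toReal) +
      inner ℝ (∑ z ∈ Θ t, pr t z • R.sub (k + 1) t z)
        (x - R.x (k + 1) (history (s (k + 1)) (t - 1))),
    ∑ z ∈ Θ t, pr t z * B z, fun k x => ?_, fun k x y => ?_, fun k x hx => ?_, fun k => by simp⟩
  · rw [hR.update k t ht htT x, EReal.coe_add, coe_real_sum]
    congr 2
    refine Finset.sum_congr rfl fun z hz => ?_
    rw [EReal.coe_mul, ← hcoe k z hz]
  · have h1 : ‖∑ z ∈ Θ t, pr t z • R.sub (k + 1) t z‖ ≤ ∑ z ∈ Θ t, pr t z * B z := by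
      refine (norm_sum_le _ _).trans (Finset.sum_le_sum fun z hz => ?_)
      rw [norm_smul, Real.norm_of_nonneg (h.pr_nonneg t (by omega) htT z hz)]
      exact mul_le_mul_of_nonneg_left (hB z hz k) (h.pr_nonneg t (by omega) htT z hz)
    have h2 := (real_inner_le_norm (∑ z ∈ Θ t, pr t z • R.sub (k + 1) t z) (x - y)).trans
      (mul_le_mul_of_nonneg_right h1 (norm_nonneg _))
    have h3 : x - R.x (k + 1) (history (s (k + 1)) (t - 1)) =
      (y - R.x (k + 1) (history (s (k + 1)) (t - 1))) + (x - y) := by abel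
    beta_reduce
    rw [h3, inner_add_right]
    linarith
  · beta_reduce
    rw [h.toReal_recourse (by omega) htT hx, sum_inner, ← Finset.sum_add_distrib]
    refine Finset.sum_le_sum fun z hz => ?_
    rw [real_inner_smul_left, ← mul_add]
    refine mul_le_mul_of_nonneg_left ?_ (h.pr_nonneg t (by omega) htT z hz)
    -- Validity of the cut: the subgradient minorizes the approximate stage value, which lies below
    -- the true one.
    have h1 := (hR.backward k t ht htT z hz x).trans (hb.stageValue_le (by omega) _ _ _)
    rw [h.coe_stageValue (by omega) htT hz hx] at h1
    beta_reduce at h1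
    rwa [hcoe k z hz, ← EReal.coe_add, EReal.coe_le_coe_iff] at h1

/-- Backward induction on the stage: bounds at stage `t + 1` make the cuts at stage `t` real-valued,
equi-Lipschitz and valid. Maxima of valid minorants stay below $\mathcal Q_t$, and the first cut
alone gives the lower bound for all later iterations. -/
theorem IsExecution.bracketed (hR : IsExecution P Θ pr lam Q₀ s visited R)
    (hs : IsPath P Θ s visited) (h : Admissible P Θ pr lam Q₀) {t : ℕ} (ht : 2 ≤ t)
    (htT : t ≤ P.T + 1) : Bracketed P Θ pr R t := by
  induction htT using Nat.decreasingInduction with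
  | self =>
    refine ⟨fun k x _ => ?_, 0, fun k x _ => ?_⟩
    · rw [hR.terminal, P.recourse_terminal]
    · rw [hR.terminal, EReal.coe_zero]
  | of_succ t htT ih =>
    obtain ⟨c, L, hc1, hc2, hc3, hc4⟩ := hR.exists_cuts hs h ht (by omega) (ih (by omega))
    have hrec := (recourse_regular h.h2 h.pr_nonneg (show 1 ≤ t by omega)
      (show t ≤ P.T + 1 by omega)).2.2
    have hX : P.stateSet (t - 1) = P.X (t - 1) := P.stateSet_of_pos (by omega)
    refine ⟨fun k x hx => ?_, ?_⟩
    · induction k with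
      | zero =>
        rw [hR.init t ht (by omega)]
        exact h.Q₀_le t ht (by omega) x (hX ▸ hx)
      | succ k ihk =>
        rw [hc1]
        refine max_le ihk ?_
        rw [hrec x hx]
        exact EReal.coe_le_coe_iff.2 (hc3 k x hx)
    -- A Lipschitz minorant of the first cut; `R.x 1 []` is merely a convenient reference point.
    · have hcont : ContinuousOn (fun x => c 0 (R.x 1 []) - L * ‖R.x 1 [] - x‖)
          (P.stateSet (t - 1)) := by fun_prop
      obtain ⟨r, hr⟩ := (isCompact_stateSet h.h2 (show t - 1 ≤ P.T by omega)).bddBelow_image hcont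
      refine ⟨r, fun k x hx => ?_⟩
      have h0 : (r : EReal) ≤ R.Q 1 t x := by
        rw [hc1]
        refine le_max_of_le_right (EReal.coe_le_coe_iff.2 ?_)
        have h1 := hr (Set.mem_image_of_mem _ hx)
        have h2 := hc2 0 (R.x 1 []) x
        beta_reduce at h1
        linarith
      have hmono : Monotone fun k => R.Q k t x := monotone_nat_of_le_succ fun k => by
        rw [hc1]; exact le_max_left _ _
      exact h0.trans (hmono (show 1 ≤ k + 1 by omega))

end Execution

/-! ### Compactness for equi-Lipschitz cuts. -/

/-- Among infinitely many equi-Lipschitz functions that are bounded above on a compact set, the late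
ones hardly exceed the maximum of their predecessors. -/
theorem exists_lt_add_of_equiLipschitz {E : Type*} [SeminormedAddCommGroup E] {X : Set E}
    (hX : IsCompact X) {c : ℕ → E → ℝ} {L M : ℝ} (hL : ∀ k x y, c k x ≤ c k y + L * ‖x - y‖)
    (hM : ∀ k, ∀ x ∈ X, c k x ≤ M) {ε : ℝ} (hε : 0 < ε) :
    ∃ N, ∀ k ≥ N, ∀ x ∈ X, ∃ j < k, c k x < c j x + ε := by
  by_contra! hcon
  obtain ⟨φ, hφ, hP⟩ := extraction_of_frequently_atTop
    (P := fun k => 0 < k ∧ ∃ x ∈ X, ∀ j < k, c j x + ε ≤ c k x) (frequently_atTop.2 fun N => by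
      -- Asking for an index beyond `N + 1` makes it positive, so function `0` is among its
      -- predecessors and bounds the selected values from below.
      obtain ⟨k, hk, h⟩ := hcon (N + 1)
      exact ⟨k, by omega, by omega, h⟩)
  choose hpos x hxX hx using hP
  have hcont : ContinuousOn (fun y => c 0 (x 0) - L * ‖x 0 - y‖) X := by fun_prop
  obtain ⟨r, hr⟩ := hX.bddBelow_image hcont
  have hmem : ∀ i, (x i, c (φ i) (x i)) ∈ X ×ˢ Set.Icc r M := fun i => by
    refine ⟨hxX i, ?_, hM _ _ (hxX i)⟩
    have h1 := hr (Set.mem_image_of_mem _ (hxX i))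
    have h2 := hL 0 (x 0) (x i)
    have h3 := hx i 0 (hpos i)
    beta_reduce at h1
    linarith
  obtain ⟨a, -, ψ, hψ, hlim⟩ := (hX.prod isCompact_Icc).tendsto_subseq hmem
  have h1 : Tendsto (fun i => x (ψ i)) atTop (𝓝 a.1) := (continuous_fst.tendsto a).comp hlim
  have h2 : Tendsto (fun i => c (φ (ψ i)) (x (ψ i))) atTop (𝓝 a.2) :=
    (continuous_snd.tendsto a).comp hlim
  have h1' := h1.comp (tendsto_add_atTop_nat 1)
  have h2' := h2.comp (tendsto_add_atTop_nat 1)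
  -- Along the convergent subsequence, consecutive values differ by at least $\varepsilon$ minus $L$
  -- times the distance of the points, and both the differences and the distances tend to zero.
  have h3 := (h2'.sub h2).add ((h1.sub h1').norm.const_mul L)
  rw [sub_self, sub_self, norm_zero, mul_zero, add_zero] at h3
  refine absurd (ge_of_tendsto' h3 fun i => ?_) (not_le.2 hε)
  have h4 := hx (ψ (i + 1)) (φ (ψ i)) (hφ (hψ (Nat.lt_succ_self i)))
  have h5 := hL (φ (ψ i)) (x (ψ i)) (x (ψ (i + 1)))
  simp only [Function.comp_apply]
  linarith

/-- Bounds the quadratic penalty uniformly over decisions and prox-centers. -/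
theorem exists_sq_norm_sub_le {X : Set (Vec n)} (hX : IsCompact X) :
    ∃ D : ℝ, ∀ a ∈ X, ∀ b ∈ X, ‖a - b‖ ^ 2 ≤ D := by
  obtain ⟨C, hC⟩ := Metric.isBounded_iff.1 hX.isBounded
  refine ⟨C ^ 2, fun a ha b hb => ?_⟩
  rw [← dist_eq_norm]
  exact pow_le_pow_left₀ dist_nonneg (hC ha hb) 2

/-! ### Propagation of the error backward through the tree. -/

section Convergence

variable {P : Problem n K p q} {Θ : ℕ → Finset (Vec K)} {pr : ℕ → Vec K → ℝ}
  {lam : ℕ → ℕ → ℝ} {Q₀ : ℕ → Vec n → EReal} {s : ℕ → ℕ → Vec K}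
  {visited : ℕ → List (Vec K) → Prop} {R : Iterates n K} {t : ℕ}

/-- The approximation error `𝒬_t(x) - 𝒬_t^k(x)` as a real number. -/
def gap (P : Problem n K p q) (Θ : ℕ → Finset (Vec K)) (pr : ℕ → Vec K → ℝ) (R : Iterates n K)
    (k t : ℕ) (x : Vec n) : ℝ :=
  (P.recourse Θ pr t x).toReal - (R.Q k t x).toReal

theorem Bracketed.gap_nonneg (hb : Bracketed P Θ pr R t) (h : Admissible P Θ pr lam Q₀)
    (ht : 1 ≤ t) (htT : t ≤ P.T + 1) (k : ℕ) {x : Vec n} (hx : x ∈ P.stateSet (t - 1)) :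
    0 ≤ gap P Θ pr R (k + 1) t x := by
  have := hb.le (k + 1) x hx
  rw [hb.coe_Q h ht htT k hx, h.coe_recourse ht htT hx, EReal.coe_le_coe_iff] at this
  exact sub_nonneg.2 this

theorem Bracketed.recourse_sub_eq_gap (hb : Bracketed P Θ pr R t) (h : Admissible P Θ pr lam Q₀)
    (ht : 1 ≤ t) (htT : t ≤ P.T + 1) (k : ℕ) {x : Vec n} (hx : x ∈ P.stateSet (t - 1)) :
    P.recourse Θ pr t x - R.Q (k + 1) t x = (gap P Θ pr R (k + 1) t x : EReal) := by
  rw [gap, EReal.coe_sub, ← hb.coe_Q h ht htT k hx, ← h.coe_recourse ht htT hx]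

/-- Successive approximations differ by arbitrarily little, uniformly on the set of states. -/
theorem IsExecution.eventually_gap_le (hR : IsExecution P Θ pr lam Q₀ s visited R)
    (hs : IsPath P Θ s visited) (h : Admissible P Θ pr lam Q₀) (ht : 2 ≤ t) (htT : t ≤ P.T)
    {ε : ℝ} (hε : 0 < ε) :
    ∀ᶠ k in atTop, ∀ x ∈ P.stateSet (t - 1),
      gap P Θ pr R k t x ≤ gap P Θ pr R (k + 1) t x + ε := by
  have hb := hR.bracketed hs h ht (by omega)
  obtain ⟨c, L, hc1, hc2, hc3, -⟩ := hR.exists_cuts hs h ht htT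
    (hR.bracketed hs h (by omega) (by omega))
  have hX := isCompact_stateSet h.h2 (show t - 1 ≤ P.T by omega)
  obtain ⟨M, hM⟩ := hX.bddAbove_image
    (recourse_regular h.h2 h.pr_nonneg (show 1 ≤ t by omega) (by omega)).1
  obtain ⟨N, hN⟩ := exists_lt_add_of_equiLipschitz hX hc2
    (fun k x hx => (hc3 k x hx).trans (hM (Set.mem_image_of_mem _ hx))) hε
  filter_upwards [eventually_ge_atTop (N + 1)] with k hk x hx
  obtain ⟨k, rfl⟩ : ∃ i, k = i + 1 := ⟨k - 1, by omega⟩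
  -- Cut `k + 1` is the one added in iteration `k + 2`, and every cut `j < k + 1` is already
  -- contained in `R.Q (k + 1) t`.
  obtain ⟨j, hj, hlt⟩ := hN (k + 1) (by omega) x hx
  have hmono : Monotone fun k => R.Q k t x := monotone_nat_of_le_succ fun k => by
    rw [hc1]; exact le_max_left _ _
  have e1 := hb.coe_Q h (by omega) (by omega) k hx
  have h1 : c j x ≤ (R.Q (k + 1) t x).toReal := by
    rw [← EReal.coe_le_coe_iff, ← e1]
    refine le_trans ?_ (hmono (show j + 1 ≤ k + 1 by omega))
    beta_reduce
    rw [hc1]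
    exact le_max_right _ _
  have h2 : (R.Q (k + 1 + 1) t x).toReal ≤ (R.Q (k + 1) t x).toReal + ε := by
    rw [hc1, e1, ← EReal.coe_strictMono.monotone.map_max, EReal.toReal_coe, EReal.toReal_coe]
    exact max_le (by linarith) (by linarith)
  simp only [gap]
  linarith

/-- The comparison of regularized, approximate and true stage problems at a computed decision. -/
theorem IsExecution.stage_bounds (hR : IsExecution P Θ pr lam Q₀ s visited R)
    (hs : IsPath P Θ s visited) (h : Admissible P Θ pr lam Q₀) (ht : t < P.T) {D : ℝ}
    (hD : ∀ a ∈ P.X (t + 1), ∀ b ∈ P.X (t + 1), ‖a - b‖ ^ 2 ≤ D) {k : ℕ} {m : List (Vec K)}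
    (hm : m ∈ nodes Θ t) (hv : visited (k + 2) m) (hxm : R.x (k + 2) m ∈ P.stateSet t)
    {z : Vec K} (hz : z ∈ Θ (t + 1)) :
    ∃ ρ σ v φ : ℝ,
      regObj P (t + 1) (R.Q (k + 1) (t + 2)) (lam (t + 1) (k + 2)) (R.prox (k + 2) (t + 1))
        (R.x (k + 2) m) (R.x (k + 2) (z :: m)) z = ρ ∧
      P.stageValue (t + 1) (R.Q (k + 1) (t + 2)) (R.x (k + 2) m) z = σ ∧
      P.stageValue (t + 1) (P.recourse Θ pr (t + 2)) (R.x (k + 2) m) z = v ∧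
      P.f (t + 1) (R.x (k + 2) m) (R.x (k + 2) (z :: m)) z = φ ∧
      φ + (R.Q (k + 1) (t + 2) (R.x (k + 2) (z :: m))).toReal ≤ ρ ∧
      ρ ≤ σ + lam (t + 1) (k + 2) * D ∧ σ ≤ v ∧
      v ≤ φ + (P.recourse Θ pr (t + 2) (R.x (k + 2) (z :: m))).toReal := by
  have hb : Bracketed P Θ pr R (t + 1 + 1) := hR.bracketed hs h (by omega) (by omega)
  obtain ⟨hf, hmin⟩ := hR.forward (k + 1) t ht m hm hv z hz
  have hym : R.x (k + 2) (z :: m) ∈ P.stateSet (t + 1 + 1 - 1) := hf.1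
  have eσ := hb.coe_stageValue h (by omega) (by omega) hz k hxm
  have ev := h.coe_stageValue (t := t + 1) (by omega) (by omega) hz hxm
  have eφ := (h.h2 (t + 1) (by omega) (by omega)).coe_f hz hxm hf.1
  have eQ := hb.coe_Q h (by omega) (by omega) k hym
  have eW := h.coe_recourse (t := t + 1 + 1) (by omega) (by omega) hym
  have hlam := h.lam_nonneg (t + 1) (k + 2) (by omega) (by omega) (by omega)
  have hρ : regObj P (t + 1) (R.Q (k + 1) (t + 2)) (lam (t + 1) (k + 2))
      (R.prox (k + 2) (t + 1)) (R.x (k + 2) m) (R.x (k + 2) (z :: m)) z =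
      (((P.f (t + 1) (R.x (k + 2) m) (R.x (k + 2) (z :: m)) z).toReal +
        (R.Q (k + 1) (t + 2) (R.x (k + 2) (z :: m))).toReal +
        lam (t + 1) (k + 2) * ‖R.x (k + 2) (z :: m) - R.prox (k + 2) (t + 1)‖ ^ 2 : ℝ) :
          EReal) := by
    rw [regObj, EReal.coe_add, EReal.coe_add, ← eφ, ← eQ]
  refine ⟨_, _, _, _, hρ, eσ, ev, eφ, ?_, ?_, ?_, ?_⟩
  · have := mul_nonneg hlam (sq_nonneg ‖R.x (k + 2) (z :: m) - R.prox (k + 2) (t + 1)‖)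
    linarith
  -- The decision beats every feasible `y` in the regularized problem, where the penalty of `y` is
  -- at most `lam * D`.
  · rw [← sub_le_iff_le_add, ← EReal.coe_le_coe_iff, ← eσ]
    refine le_iInf₂ fun y hy => ?_
    have hyX : y ∈ P.stateSet (t + 1 + 1 - 1) := hy.1
    have h1 := hmin y hy
    have h2 := mul_le_mul_of_nonneg_left
      (hD y hy.1 _ (hR.prox_mem (k + 1) (t + 1) (by omega) (by omega))) hlam
    have ef := (h.h2 (t + 1) (by omega) (by omega)).coe_f hz hxm hy.1
    have eq := hb.coe_Q h (by omega) (by omega) k hyX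
    rw [hρ, regObj] at h1
    rw [ef, eq, ← EReal.coe_add, ← EReal.coe_add, EReal.coe_le_coe_iff] at h1
    rw [ef, eq, ← EReal.coe_add, EReal.coe_le_coe_iff]
    linarith
  · have := hb.stageValue_le (by omega) (k + 1) (R.x (k + 2) m) z
    rwa [eσ, ev, EReal.coe_le_coe_iff] at this
  · have := P.stageValue_le (P.recourse Θ pr (t + 1 + 1)) hf
    rwa [ev, eφ, eW, ← EReal.coe_add, EReal.coe_le_coe_iff] at this

/-- The error at a sampled node is controlled by the errors at its children. -/
theorem IsExecution.gap_sampled_le (hR : IsExecution P Θ pr lam Q₀ s visited R)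
    (hs : IsPath P Θ s visited) (h : Admissible P Θ pr lam Q₀) (ht : 1 ≤ t) (htT : t < P.T)
    {D : ℝ} (hD : ∀ a ∈ P.X (t + 1), ∀ b ∈ P.X (t + 1), ‖a - b‖ ^ 2 ≤ D) {k : ℕ}
    {m : List (Vec K)} (hm : history (s (k + 2)) t = m) :
    gap P Θ pr R (k + 2) (t + 1) (R.x (k + 2) m) ≤
      ∑ z ∈ Θ (t + 1), pr (t + 1) z *
        (gap P Θ pr R (k + 1) (t + 2) (R.x (k + 2) (z :: m)) + lam (t + 1) (k + 2) * D) := by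
  have hb : Bracketed P Θ pr R (t + 1 + 1) := hR.bracketed hs h (by omega) (by omega)
  have hxm : R.x (k + 2) m ∈ P.stateSet (t + 1 - 1) := hm ▸ hR.sampled_mem hs (by omega)
  obtain ⟨c, L, hc1, -, hc3, hc4⟩ := hR.exists_cuts hs h (t := t + 1) (by omega) (by omega) hb
  have h4 := hc4 (k + 1)
  rw [Nat.add_sub_cancel, hm] at h4
  have h5 : c (k + 1) (R.x (k + 2) m) ≤ (R.Q (k + 2) (t + 1) (R.x (k + 2) m)).toReal := by
    rw [← EReal.coe_le_coe_iff, ← (hR.bracketed hs h (t := t + 1) (by omega) (by omega)).coe_Q h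
      (by omega) (by omega) (k + 1) hxm, hc1]
    exact le_max_right _ _
  have h6 := h.toReal_recourse (t := t + 1) (by omega) (by omega) hxm
  rw [gap, h6]
  refine (sub_le_sub_left h5 _).trans ?_
  rw [h4, ← Finset.sum_sub_distrib]
  refine Finset.sum_le_sum fun z hz => ?_
  rw [← mul_sub]
  refine mul_le_mul_of_nonneg_left ?_ (h.pr_nonneg _ (by omega) (by omega) z hz)
  obtain ⟨ρ, σ, v, φ, -, hσ, hv, -, h7, h8, -, h10⟩ := hR.stage_bounds hs h htT hD
    (hm ▸ hs.sampled_mem_nodes htT.le) (hm ▸ hs.visited_history _ _) hxm hz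
  -- The cut uses the freshly updated next-stage function, the forward pass the older one; updates
  -- only increase it.
  have h11 : P.stageValue (t + 1) (R.Q (k + 1) (t + 2)) (R.x (k + 2) m) z ≤
      P.stageValue (t + 1) (R.Q (k + 1 + 1) (t + 1 + 1)) (R.x (k + 2) m) z := by
    refine P.stageValue_mono (fun y _ => ?_) _ _
    rcases Nat.lt_or_ge (t + 1) P.T with h' | h'
    · obtain ⟨c', L', hc', -⟩ := hR.exists_cuts hs h (t := t + 2) (by omega) (by omega)
        (hR.bracketed hs h (by omega) (by omega))
      rw [hc' (k + 1)]
      exact le_max_left _ _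
    · have : t + 1 = P.T := by omega
      simp only [show t + 2 = P.T + 1 by omega, hR.terminal,
        le_refl]
  rw [hσ, hb.coe_stageValue h (by omega) (by omega) hz (k + 1) hxm, EReal.coe_le_coe_iff] at h11
  rw [hv, EReal.toReal_coe, gap]
  have : R.x (k + 1 + 1) m = R.x (k + 2) m := rfl
  linarith

/-- If errors that are large infinitely often at a node are large infinitely often at iterations
sampling this node, then all errors vanish asymptotically. -/
theorem IsExecution.eventually_gap_lt (hR : IsExecution P Θ pr lam Q₀ s visited R)
    (hs : IsPath P Θ s visited) (h : Admissible P Θ pr lam Q₀)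
    (hrec : ∀ t, 1 ≤ t → t < P.T → ∀ m z, z :: m ∈ nodes Θ t → ∀ j : ℕ,
      (∃ᶠ k in atTop, visited (k + 1) m ∧
        1 / ((j : ℝ) + 1) ≤ gap P Θ pr R k (t + 1) (R.x (k + 1) (z :: m))) →
      ∃ᶠ k in atTop, history (s (k + 1)) t = z :: m ∧
        1 / ((j : ℝ) + 1) ≤ gap P Θ pr R k (t + 1) (R.x (k + 1) (z :: m)))
    (ht : 1 ≤ t) (htT : t ≤ P.T) (m : List (Vec K)) (z : Vec K) (hm : z :: m ∈ nodes Θ t)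
    {ε : ℝ} (hε : 0 < ε) :
    ∀ᶠ k in atTop, visited (k + 1) m →
      gap P Θ pr R k (t + 1) (R.x (k + 1) (z :: m)) < ε := by
  induction htT using Nat.decreasingInduction generalizing m z ε with
  | self => exact .of_forall fun k _ => by simpa [gap, hR.terminal, P.recourse_terminal] using hε
  | of_succ t htT ih =>
    -- Error budget at sampled nodes: $\varepsilon/4$ each for the gaps at the children, for the
    -- penalty, and for going back from the updated approximation to the previous one. The
    -- probability weights sum to one.
    have hsamp : ∀ ε : ℝ, 0 < ε → ∀ᶠ k in atTop, history (s (k + 1)) t = z :: m →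
        gap P Θ pr R k (t + 1) (R.x (k + 1) (z :: m)) < ε := by
      intro ε hε
      obtain ⟨D, hD⟩ := exists_sq_norm_sub_le (h.h2 (t + 1) (by omega) (by omega)).X_compact
      have hchild : ∀ᶠ k in atTop, ∀ z' ∈ Θ (t + 1), visited (k + 1) (z :: m) →
          gap P Θ pr R k (t + 2) (R.x (k + 1) (z' :: z :: m)) < ε / 4 := by
        rw [Filter.eventually_all_finset]
        exact fun z' hz' => ih (by omega) (z :: m) z' (cons_mem_nodes.2 ⟨hz', hm⟩) (by linarith)
      have hlam : ∀ᶠ k in atTop, lam (t + 1) (k + 1) * D < ε / 4 := by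
        have := ((h.lam_lim (t + 1) (by omega) (by omega)).comp
          (tendsto_add_atTop_nat 1)).mul_const D
        rw [zero_mul] at this
        exact this.eventually_lt_const (by linarith)
      filter_upwards [hchild, hlam, hR.eventually_gap_le hs h (t := t + 1) (by omega) (by omega)
        (show 0 < ε / 4 by linarith), eventually_ge_atTop 1] with k h1 h2 h3 h4 hk
      obtain ⟨k, rfl⟩ : ∃ i, k = i + 1 := ⟨k - 1, by omega⟩
      have hxm : R.x (k + 2) (z :: m) ∈ P.stateSet (t + 1 - 1) :=
        hk ▸ hR.sampled_mem hs (by omega)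
      have h5 := h3 _ hxm
      have h6 := hR.gap_sampled_le hs h ht htT hD hk
      have h7 : ∑ z' ∈ Θ (t + 1), pr (t + 1) z' *
          (gap P Θ pr R (k + 1) (t + 2) (R.x (k + 2) (z' :: z :: m)) +
            lam (t + 1) (k + 2) * D) ≤ ∑ z' ∈ Θ (t + 1), pr (t + 1) z' * (ε / 2) := by
        refine Finset.sum_le_sum fun z' hz' => mul_le_mul_of_nonneg_left ?_
          (h.pr_nonneg _ (by omega) (by omega) z' hz')
        have := h1 z' hz' (hk ▸ hs.visited_history _ _)
        linarith
      rw [← Finset.sum_mul, h.pr_sum _ (by omega) (by omega)] at h7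
      have : R.x (k + 1 + 1) (z :: m) = R.x (k + 2) (z :: m) := rfl
      linarith
    -- The thresholds $1/(j+1)$ suffice and are countable, so the recurrence hypothesis can hold
    -- almost surely for all of them at once.
    obtain ⟨j, hj⟩ := exists_nat_one_div_lt hε
    by_contra hcon
    rw [Filter.not_eventually] at hcon
    obtain ⟨k, hk, hk'⟩ := ((hrec t ht htT m z hm j (hcon.mono fun k hk => by
      rw [Classical.not_imp, not_lt] at hk
      exact ⟨hk.1, hj.le.trans hk.2⟩)).and_eventually
        (hsamp (1 / ((j : ℝ) + 1)) Nat.one_div_pos_of_nat)).exists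
    exact absurd (hk' hk.1) (not_lt.2 hk.2)

end Convergence

/-! ### Conditional Borel–Cantelli. -/

section BorelCantelli

variable {Ω : Type*} [m0 : MeasurableSpace Ω] {μ : Measure Ω}

/-- If the past events `A k` occur infinitely often, and the events `B (k + 1)` have a fixed
positive probability and are independent of the past, then `A k` and `B (k + 1)` occur together infinitely
often. -/
theorem ae_frequently_and_of_indep [IsProbabilityMeasure μ] (ℱ : Filtration ℕ m0)
    {A B : ℕ → Set Ω} (hA : ∀ k, MeasurableSet[ℱ k] (A k))
    (hB : ∀ k, MeasurableSet[ℱ k] (B k)) {c : ℝ} (hc : 0 < c)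
    (hind : ∀ k F, MeasurableSet[ℱ k] F → μ.real (F ∩ B (k + 1)) = c * μ.real F) :
    ∀ᵐ ω ∂μ, (∃ᶠ k in atTop, ω ∈ A k) → ∃ᶠ k in atTop, ω ∈ A k ∧ ω ∈ B (k + 1) := by
  -- The shift makes `E` adapted. By independence the conditional probability of `E (k + 1)` given
  -- `ℱ k` is `c` on `A k` and zero elsewhere, so its sum diverges exactly when `A` recurs. The
  -- index `0` is immaterial.
  let E : ℕ → Set Ω := fun k => A (k - 1) ∩ B k
  have hE : ∀ k, MeasurableSet[ℱ k] (E k) := fun k =>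
    (ℱ.mono (Nat.sub_le k 1) _ (hA (k - 1))).inter (hB k)
  have hcond : ∀ k, (A k).indicator (fun _ => c) =ᵐ[μ]
      μ[(E (k + 1)).indicator (1 : Ω → ℝ) | ℱ k] := by
    intro k
    have hAm : MeasurableSet (A k) := ℱ.le k _ (hA k)
    have hEm : MeasurableSet (E (k + 1)) := ℱ.le _ _ (hE (k + 1))
    refine ae_eq_condExp_of_forall_setIntegral_eq (ℱ.le k) ?_ ?_ ?_ ?_
    · exact (integrable_const (1 : ℝ)).indicator hEm
    · exact fun F _ _ => ((integrable_const c).indicator hAm).integrableOn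
    · intro F hF _
      have hFm : MeasurableSet F := ℱ.le k _ hF
      rw [setIntegral_indicator hAm, setIntegral_indicator hEm]
      simp only [integral_const, measureReal_restrict_apply_univ, smul_eq_mul, Pi.one_apply,
        mul_one]
      have : F ∩ E (k + 1) = (F ∩ A k) ∩ B (k + 1) := by
        simp only [E, Nat.add_sub_cancel, Set.inter_assoc]
      rw [this, hind k _ (hF.inter (hA k)), mul_comm]
    · exact (stronglyMeasurable_const.indicator (hA k)).aestronglyMeasurable
  filter_upwards [ae_mem_limsup_atTop_iff μ hE, ae_all_iff.2 hcond] with ω h1 h2 hfreq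
  have h3 : ω ∈ limsup A atTop := mem_limsup_iff_frequently_mem.2 hfreq
  rw [Set.limsup_eq_tendsto_sum_indicator_atTop hc A] at h3
  have h4 : ω ∈ limsup E atTop := by
    rw [h1]
    refine h3.congr fun N => Finset.sum_congr rfl fun k _ => h2 k
  rw [mem_limsup_iff_frequently_mem, frequently_atTop] at h4
  rw [frequently_atTop]
  intro N
  obtain ⟨k, hk, hω⟩ := h4 (N + 1)
  obtain ⟨k, rfl⟩ : ∃ i, k = i + 1 := ⟨k - 1, by omega⟩
  exact ⟨k, by omega, hω⟩

end BorelCantelli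

/-! ### Sampling: measurability, independence and recurrence. -/

section Sampling

variable {Ω : Type*} {T : ℕ} {Θ : ℕ → Finset (Vec K)} {s : ℕ → ℕ → Ω → Vec K} {ξ₁ : Vec K}

/-- The σ-algebra is a parameter because the ambient one, those of past samples and those of earlier
stages are all needed. -/
theorem measurableSet_nodeEvent (m' : MeasurableSpace Ω) {ξ : ℕ → Ω → Vec K} (m : List (Vec K))
    (h : ∀ t, 1 ≤ t → t ≤ m.length → Measurable[m'] (ξ t)) :
    MeasurableSet[m'] (nodeEvent ξ m) := by
  induction m with
  | nil => simp [nodeEvent, history]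
  | cons z m ih =>
    have e : nodeEvent ξ (z :: m) = ξ (m.length + 1) ⁻¹' {z} ∩ nodeEvent ξ m := by
      ext ω
      simp [nodeEvent, history]
    rw [e]
    exact (h _ (by omega) (by simp) (measurableSet_singleton z)).inter
      (ih fun t h1 h2 => h t h1 (by simp; omega))

theorem nodeEvent_cons (ξ : ℕ → Ω → Vec K) (z : Vec K) (m : List (Vec K)) :
    nodeEvent ξ (z :: m) = nodeEvent ξ m ∩ {ω | ξ (m.length + 1) ω = z} := by
  ext ω
  simp [nodeEvent, history, and_comm]

theorem nodeEvent_nil (ξ : ℕ → Ω → Vec K) : nodeEvent ξ [] = Set.univ := by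
  simp [nodeEvent, history]

/-- The σ-algebra generated by the samples of the iterations `1, …, k`. -/
abbrev pastSamples (T : ℕ) (s : ℕ → ℕ → Ω → Vec K) (k : ℕ) : MeasurableSpace Ω :=
  ⨆ (j : ℕ) (r : ℕ) (_ : 1 ≤ j ∧ j ≤ k ∧ 2 ≤ r ∧ r ≤ T),
    MeasurableSpace.comap (s j r) inferInstance

theorem measurable_pastSamples {k j r : ℕ} (h : 1 ≤ j ∧ j ≤ k ∧ 2 ≤ r ∧ r ≤ T) :
    Measurable[pastSamples T s k] (s j r) := by
  rw [measurable_iff_comap_le]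
  exact le_iSup_of_le j (le_iSup_of_le r (le_iSup_of_le h le_rfl))

theorem pastSamples_le {k : ℕ} {m' : MeasurableSpace Ω}
    (h : ∀ j r, 1 ≤ j → j ≤ k → 2 ≤ r → r ≤ T → Measurable[m'] (s j r)) :
    pastSamples T s k ≤ m' :=
  iSup_le fun j => iSup_le fun r => iSup_le fun hjr =>
    measurable_iff_comap_le.1 (h j r hjr.1 hjr.2.1 hjr.2.2.1 hjr.2.2.2)

/-- Events determined by the samples of the first `k` iterations are measurable. -/
theorem measurableSet_pastSamples {k : ℕ}
    (hs : ∀ j r, 1 ≤ j → 1 ≤ r → r ≤ T → ∀ ω, s j r ω ∈ Θ r) {A : Set Ω}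
    (hA : ∀ ω ω', SameSamples T s k ω ω' → ω ∈ A → ω' ∈ A) :
    MeasurableSet[pastSamples T s k] A := by
  let ι := {a : Fin (k + 1) × Fin (T + 1) // 1 ≤ (a.1 : ℕ) ∧ 2 ≤ (a.2 : ℕ)}
  let S : Ω → ι → Vec K := fun ω a => s a.1.1 a.1.2 ω
  have hS : Measurable[pastSamples T s k] S := by
    refine @measurable_pi_lambda _ _ _ (pastSamples T s k) _ S fun a => ?_
    exact measurable_pastSamples ⟨a.2.1, by have := a.1.1.2; omega, a.2.2, by
      have := a.1.2.2; omega⟩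
  -- The samples take finitely many values, so any set that is a union of fibres of `S` is
  -- measurable. No measurable choice of decisions or subgradients is required.
  have hfin : (Set.range S).Finite := by
    refine (Set.Finite.pi' (t := fun a : ι => (Θ a.1.2 : Set (Vec K)))
      fun a => Finset.finite_toSet _).subset ?_
    rintro _ ⟨ω, rfl⟩ a
    exact hs _ _ a.2.1 (by have := a.2.2; omega) (by have := a.1.2.2; omega) ω
  have e : A = S ⁻¹' (S '' A) := by
    refine (Set.subset_preimage_image S A).antisymm ?_
    rintro ω ⟨ω', hω', h⟩
    refine hA ω' ω (fun j r h1 h2 h3 h4 => ?_) hω'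
    exact congrFun h ⟨(⟨j, by omega⟩, ⟨r, by omega⟩), h1, h3⟩
  rw [e]
  exact hS (hfin.subset (Set.image_subset_range S A)).measurableSet

theorem history_eq_of_forall {α : Type*} {a b : ℕ → α} {t : ℕ}
    (h : ∀ i, 1 ≤ i → i ≤ t → a i = b i) : history a t = history b t := by
  induction t with
  | zero => rfl
  | succ t ih =>
    rw [history, history, h (t + 1) (by omega) le_rfl, ih fun i h1 h2 => h i h1 (by omega)]

theorem SameSamples.mono {k l : ℕ} {ω ω' : Ω} (h : SameSamples T s l ω ω') (hkl : k ≤ l) :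
    SameSamples T s k ω ω' := fun j t h1 h2 h3 h4 => h j t h1 (h2.trans hkl) h3 h4

variable [m0 : MeasurableSpace Ω] {μ : Measure Ω} {ξ : ℕ → Ω → Vec K}

/-- The filtration generated by the samples. -/
def sampleFiltration (h3 : H3 T μ ξ Θ s) : Filtration ℕ m0 where
  seq := pastSamples T s
  mono' _ _ hkl := pastSamples_le fun _ _ h1 h2 h3 h4 =>
    measurable_pastSamples ⟨h1, h2.trans hkl, h3, h4⟩
  le' _ := pastSamples_le fun j r h1 _ h4 h5 => h3.measurable j r h1 h4 h5

theorem H3.sample_one (h3 : H3 T μ ξ Θ s) (hfirst : Θ 1 = {ξ₁}) (hT : 1 ≤ T) {k : ℕ}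
    (hk : 1 ≤ k) : s k 1 = fun _ => ξ₁ := by
  funext ω
  simpa [hfirst] using h3.mem_support k 1 hk le_rfl hT ω

/-- A node is sampled in each iteration with the same positive probability, independently of the
previous iterations. -/
theorem H3.exists_nodeEvent_prob [IsProbabilityMeasure μ] (h3 : H3 T μ ξ Θ s)
    (hfirst : Θ 1 = {ξ₁}) {t : ℕ} (ht : t ≤ T) {m : List (Vec K)} (hm : m ∈ nodes Θ t) :
    ∃ c : ℝ, 0 < c ∧ ∀ k F, MeasurableSet[pastSamples T s k] F →
      μ.real (F ∩ nodeEvent (s (k + 1)) m) = c * μ.real F := by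
  induction t generalizing m with
  | zero =>
    obtain rfl : m = [] := by simpa [nodes] using hm
    exact ⟨1, one_pos, fun k F _ => by simp [nodeEvent, history]⟩
  | succ t ih =>
    obtain ⟨z, hz, m, hm', rfl⟩ := mem_nodes_succ.1 hm
    obtain ⟨c, hc, h⟩ := ih (by omega) hm'
    have hl := length_of_mem_nodes hm'
    -- The first stage is deterministic and contributes no factor.
    rcases Nat.eq_zero_or_pos t with rfl | ht0
    · refine ⟨c, hc, fun k F hF => ?_⟩
      have hz' : z = ξ₁ := by simpa [hfirst] using hz
      rw [nodeEvent_cons, hl, h3.sample_one hfirst ht (by omega), hz', ← h k F hF]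
      simp
    · have hne : 2 ≤ t + 1 := by omega
      refine ⟨stageProb μ ξ (t + 1) z * c,
        mul_pos (h3.law 1 (t + 1) le_rfl hne ht z hz).2 hc, fun k F hF => ?_⟩
      rw [mul_assoc, ← h k F hF, ← (h3.law (k + 1) (t + 1) (by omega) hne ht z hz).1,
        nodeEvent_cons, hl, ← Set.inter_assoc, Set.inter_comm]
      have hind := (Indep_iff _ _ μ).1 (h3.indep (k + 1) (t + 1) (by omega) hne ht)
        {ω | s (k + 1) (t + 1) ω = z} (F ∩ nodeEvent (s (k + 1)) m)
        ⟨{z}, measurableSet_singleton z, rfl⟩ ?_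
      · simp only [Measure.real, hind, ENNReal.toReal_mul]
      -- `F` belongs to earlier iterations and the event of `m` to earlier stages of the same
      -- iteration; both lie in the σ-algebra independent of the new sample.
      · refine @MeasurableSet.inter _ (_) _ _ ?_ ?_
        · refine pastSamples_le (fun j r h1 h2 h4 h5 => ?_) F hF
          rw [measurable_iff_comap_le]
          exact le_iSup_of_le j (le_iSup_of_le r (le_iSup_of_le
            ⟨h1, h4, h5, Or.inl (by omega)⟩ le_rfl))
        · refine measurableSet_nodeEvent _ m fun r h1 h2 => ?_
          rcases Nat.lt_or_ge r 2 with h | h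
          · obtain rfl : r = 1 := by omega
            rw [h3.sample_one hfirst (by omega) (by omega)]
            exact measurable_const
          · rw [measurable_iff_comap_le]
            exact le_iSup_of_le (k + 1) (le_iSup_of_le r (le_iSup_of_le
              ⟨by omega, h, by omega, Or.inr ⟨rfl, by omega⟩⟩ le_rfl))

/-- Events determined by the past which occur infinitely often occur infinitely often together with
the sampling of a given node. -/
theorem H3.ae_frequently_sampled [IsProbabilityMeasure μ] (h3 : H3 T μ ξ Θ s)
    (hfirst : Θ 1 = {ξ₁}) {t : ℕ} (ht : t ≤ T) {m : List (Vec K)} (hm : m ∈ nodes Θ t)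
    {A : ℕ → Set Ω} (hA : ∀ k ω ω', SameSamples T s k ω ω' → ω ∈ A k → ω' ∈ A k) :
    ∀ᵐ ω ∂μ, (∃ᶠ k in atTop, ω ∈ A k) → ∃ᶠ k in atTop, ω ∈ A k ∧ Sampled s ω (k + 1) m := by
  obtain ⟨c, hc, h⟩ := h3.exists_nodeEvent_prob hfirst ht hm
  -- Nothing is assumed about the samples with index `0`, hence the empty set.
  let B : ℕ → Set Ω := fun k => if k = 0 then ∅ else nodeEvent (s k) m
  refine ae_frequently_and_of_indep (sampleFiltration h3) (B := B)
    (fun k => measurableSet_pastSamples (fun j r => h3.mem_support j r) (hA k)) (fun k => ?_) hc h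
  simp only [B]
  split_ifs with hk
  · exact @MeasurableSet.empty _ (_)
  · refine measurableSet_nodeEvent _ m fun r h1 h2 => ?_
    have hl := length_of_mem_nodes hm
    rcases Nat.lt_or_ge r 2 with h | h
    · obtain rfl : r = 1 := by omega
      rw [h3.sample_one hfirst (by omega) (by omega)]
      exact measurable_const
    · exact measurable_pastSamples ⟨by omega, le_rfl, h, by omega⟩

variable {P : Problem n K p q} {pr : ℕ → Vec K → ℝ} {lam : ℕ → ℕ → ℝ}
  {Q₀ : ℕ → Vec n → EReal} {visited : Ω → ℕ → List (Vec K) → Prop} {R : Ω → Iterates n K}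

/-- The approximate recourse functions are determined by the past samples. -/
theorem IsRandomExecution.Q_eq (hE : IsRandomExecution P Θ pr lam Q₀ s visited R)
    (h3 : H3 P.T μ ξ Θ s) (hfirst : Θ 1 = {ξ₁})
    (hvis : ∀ ω k m, Sampled s ω k m → visited ω k m) {k : ℕ} {ω ω' : Ω}
    (hω : SameSamples P.T s k ω ω') {t : ℕ} (ht : 2 ≤ t) (htT : t ≤ P.T + 1) :
    (R ω).Q k t = (R ω').Q k t := by
  induction k generalizing t with
  | zero =>
    rcases Nat.lt_or_ge P.T t with h | h
    · obtain rfl : t = P.T + 1 := by omega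
      rw [(hE.execution ω).terminal, (hE.execution ω').terminal]
    · rw [(hE.execution ω).init t ht h, (hE.execution ω').init t ht h]
  | succ k ih =>
    -- Within an iteration the cut of stage `t` depends on the already updated function of stage `t
    -- + 1`, hence a backward induction inside the one on iterations.
    induction htT using Nat.decreasingInduction with
    | self => rw [(hE.execution ω).terminal, (hE.execution ω').terminal]
    | of_succ t htT iht =>
      have hk := hω.mono (Nat.le_succ k)
      have hsamp : ∀ r ≤ P.T, history (fun t => s (k + 1) t ω) r =
          history (fun t => s (k + 1) t ω') r := fun r hr => by
        refine history_eq_of_forall fun i h1 h2 => ?_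
        rcases Nat.lt_or_ge i 2 with h | h
        · obtain rfl : i = 1 := by omega
          rw [h3.sample_one hfirst (by omega) (by omega)]
        · exact hω (k + 1) i (by omega) le_rfl h (by omega)
      have hmem : ∀ r ≤ P.T, history (fun t => s (k + 1) t ω) r ∈ nodes Θ r := fun r hr =>
        history_mem_nodes fun i h1 h2 => h3.mem_support (k + 1) i (by omega) h1 (by omega) ω
      have hx : (R ω).x (k + 1) (history (fun t => s (k + 1) t ω) (t - 1)) =
          (R ω').x (k + 1) (history (fun t => s (k + 1) t ω') (t - 1)) := by
        rw [← hsamp _ (by omega)]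
        obtain ⟨r, rfl⟩ : ∃ r, t = r + 2 := ⟨t - 2, by omega⟩
        have h1 : history (fun t => s (k + 1) t ω) (r + 2 - 1) =
          s (k + 1) (r + 1) ω :: history (fun t => s (k + 1) t ω) r := rfl
        rw [h1]
        refine hE.nonanticipative.x k ω ω' hk r (by omega) _ (hmem r (by omega))
          (hvis _ _ _ ?_) (hvis _ _ _ ?_) _ (h3.mem_support _ _ (by omega) (by omega) (by omega) ω)
        · rw [Sampled, length_history]
        · rw [Sampled, length_history, hsamp r (by omega)]
      have hsub : ∀ z ∈ Θ t, (R ω).sub (k + 1) t z = (R ω').sub (k + 1) t z := fun z hz =>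
        hE.nonanticipative.sub k ω ω' hω t ht (by omega) z hz
      funext x
      rw [(hE.execution ω).update k t ht (by omega), (hE.execution ω').update k t ht (by omega)]
      rw [hx, iht (by omega), ih hk ht (by omega),
        Finset.sum_congr (g := fun z => pr t z • (R ω').sub (k + 1) t z) rfl fun z hz => by
          rw [hsub z hz]]

/-- Almost surely, the approximation errors vanish asymptotically at all computed decisions. -/
theorem IsRandomExecution.ae_eventually_gap_lt [IsProbabilityMeasure μ]
    (hE : IsRandomExecution P Θ pr lam Q₀ s visited R) (h : Admissible P Θ pr lam Q₀)
    (h3 : H3 P.T μ ξ Θ s) (hfirst : Θ 1 = {ξ₁})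
    (hvis : ∀ ω k m, Sampled s ω k m → visited ω k m) :
    ∀ᵐ ω ∂μ, ∀ t, 1 ≤ t → t ≤ P.T → ∀ m z, z :: m ∈ nodes Θ t → ∀ ε > 0,
      ∀ᶠ k in atTop, visited ω (k + 1) m →
        gap P Θ pr (R ω) k (t + 1) ((R ω).x (k + 1) (z :: m)) < ε := by
  have hrec : ∀ᵐ ω ∂μ, ∀ t, ∀ m' ∈ nodes Θ t, ∀ j : ℕ, ∀ m z, m' = z :: m → 1 ≤ t → t < P.T →
      (∃ᶠ k in atTop, visited ω (k + 1) m ∧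
        1 / ((j : ℝ) + 1) ≤ gap P Θ pr (R ω) k (t + 1) ((R ω).x (k + 1) (z :: m))) →
      ∃ᶠ k in atTop, history (fun t => s (k + 1) t ω) t = z :: m ∧
        1 / ((j : ℝ) + 1) ≤ gap P Θ pr (R ω) k (t + 1) ((R ω).x (k + 1) (z :: m)) := by
    refine ae_all_iff.2 fun t => (ae_ball_iff (nodes Θ t).countable_toSet).2 fun m' hm' =>
      ae_all_iff.2 fun j => ?_
    by_cases hcase : (∃ z m, m' = z :: m) ∧ 1 ≤ t ∧ t < P.T
    swap
    · exact .of_forall fun ω m z hz h1 h2 => absurd ⟨⟨z, m, hz⟩, h1, h2⟩ hcase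
    obtain ⟨⟨z, m, rfl⟩, ht, htT⟩ := hcase
    have hm : z ∈ Θ t ∧ m ∈ nodes Θ (t - 1) := by
      obtain ⟨r, rfl⟩ : ∃ r, t = r + 1 := ⟨t - 1, by omega⟩
      exact cons_mem_nodes.1 hm'
    -- Whether `m` is visited in iteration `k + 1` may depend on the samples of that iteration.
    -- Saturating the event over outcomes with the same past makes it past-determined.
    let A : ℕ → Set Ω := fun k => {ω | ∃ ω', SameSamples P.T s k ω ω' ∧ visited ω' (k + 1) m ∧
      1 / ((j : ℝ) + 1) ≤ gap P Θ pr (R ω') k (t + 1) ((R ω').x (k + 1) (z :: m))}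
    have hA : ∀ k ω ω', SameSamples P.T s k ω ω' → ω ∈ A k → ω' ∈ A k := by
      rintro k ω ω' h ⟨ω'', h', h''⟩
      exact ⟨ω'', fun a b h1 h2 h3 h4 => (h a b h1 h2 h3 h4).symm.trans (h' a b h1 h2 h3 h4), h''⟩
    filter_upwards [h3.ae_frequently_sampled hfirst htT.le hm' hA] with ω hω m₁ z₁ he _ _ hfreq
    obtain ⟨rfl, rfl⟩ := List.cons.inj he
    refine (hω (hfreq.mono fun k hk => ⟨ω, fun _ _ _ _ _ _ => rfl, hk⟩)).mono ?_
    rintro k ⟨⟨ω', hω', hv, hg⟩, hsamp⟩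
    have hl := length_of_mem_nodes hm'
    rw [Sampled] at hsamp
    refine ⟨hl ▸ hsamp, ?_⟩
    -- Sampling `z :: m` also samples its parent, so the decision is computed under `ω` itself and,
    -- by nonanticipativity, agrees with that under `ω'`.
    have hv' : visited ω (k + 1) m := hvis _ _ _ (history_cons.1 hsamp).2
    have hx : (R ω).x (k + 1) (z :: m) = (R ω').x (k + 1) (z :: m) :=
      hE.nonanticipative.x k ω ω' hω' (t - 1) (by omega) m hm.2 hv' hv z
        (by rw [Nat.sub_add_cancel ht]; exact hm.1)
    rwa [gap, hx, hE.Q_eq h3 hfirst hvis hω' (by omega) (by omega)]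
  filter_upwards [hrec] with ω hω t ht htT m z hm ε hε
  have hpath : IsPath P Θ (fun k t => s k t ω) (visited ω) :=
    ⟨fun k t h1 h2 h4 => h3.mem_support k t h1 h2 h4 ω, fun k m hm => hvis ω k m hm⟩
  exact (hE.execution ω).eventually_gap_lt hpath h
    (fun t h1 h2 m z hm j => hω t _ hm j m z rfl h1 h2) ht htT m z hm hε

end Sampling

/-! ### Independence of the noise, nested values and policy costs. -/

section NoiseProcess

variable {Ω : Type*} [MeasurableSpace Ω] {μ : Measure Ω} {T : ℕ} {ξ : ℕ → Ω → Vec K}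
  {Θ : ℕ → Finset (Vec K)} {ξ₁ : Vec K}

theorem H1.measurableSet_eq (h1 : H1 T μ ξ Θ ξ₁) {t : ℕ} (ht : 1 ≤ t) (htT : t ≤ T) (z : Vec K) :
    MeasurableSet {ω | ξ t ω = z} :=
  h1.measurable t ht htT (measurableSet_singleton z)

theorem H1.sum_stageProb [IsProbabilityMeasure μ] (h1 : H1 T μ ξ Θ ξ₁) {t : ℕ} (ht : 1 ≤ t)
    (htT : t ≤ T) : ∑ z ∈ Θ t, stageProb μ ξ t z = 1 := by
  have hd : (Θ t : Set (Vec K)).PairwiseDisjoint fun z => {ω | ξ t ω = z} := by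
    intro a _ b _ hab
    refine Set.disjoint_left.2 fun ω ha hb => hab ?_
    exact ha.symm.trans hb
  have hu := measureReal_biUnion_finset (μ := μ) hd fun z _ => h1.measurableSet_eq ht htT z
  simp only [stageProb]
  rw [← hu, ← probReal_univ (μ := μ)]
  refine measureReal_congr (eventuallyEq_univ.2 ?_)
  filter_upwards [h1.mem_support t ht htT] with ω hω
  simpa using hω

/-- The next noise vector is independent of the σ-algebra generated by all the earlier ones
together. -/
theorem H1.nodeEvent_prob_cons (h1 : H1 T μ ξ Θ ξ₁) {m : List (Vec K)} (hm : m.length < T)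
    (z : Vec K) : μ.real (nodeEvent ξ (z :: m)) =
      stageProb μ ξ (m.length + 1) z * μ.real (nodeEvent ξ m) := by
  have hle : ∀ i : Set.Icc 1 T, MeasurableSpace.comap (ξ i) inferInstance ≤ ‹MeasurableSpace Ω› :=
    fun i => (h1.measurable i i.2.1 i.2.2).comap_le
  have hdis : Disjoint {i : Set.Icc 1 T | (i : ℕ) = m.length + 1} {i | (i : ℕ) ≤ m.length} :=
    Set.disjoint_left.2 fun i h h' => by
      rw [Set.mem_ofPred_eq] at h h'
      omega
  have hind := (Indep_iff _ _ μ).1 (indep_iSup_of_disjoint hle h1.indep.iIndep hdis)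
    {ω | ξ (m.length + 1) ω = z} (nodeEvent ξ m) ?_ ?_
  · rw [nodeEvent_cons, Set.inter_comm, measureReal_def, hind, ENNReal.toReal_mul]
    rfl
  · refine (le_iSup₂_of_le (f := fun (i : Set.Icc 1 T) (_ : i ∈ _) =>
      MeasurableSpace.comap (ξ i) inferInstance) ⟨m.length + 1, by omega, by omega⟩ rfl le_rfl) _ ?_
    exact ⟨{z}, measurableSet_singleton z, rfl⟩
  · refine measurableSet_nodeEvent _ m fun t h2 h3 => ?_
    rw [measurable_iff_comap_le]
    exact le_iSup₂_of_le (f := fun (i : Set.Icc 1 T) (_ : i ∈ _) =>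
      MeasurableSpace.comap (ξ i) inferInstance) ⟨t, h2, by omega⟩ h3 le_rfl

theorem H1.nodeEvent_prob_pos [IsProbabilityMeasure μ] (h1 : H1 T μ ξ Θ ξ₁) {t : ℕ} (ht : t ≤ T)
    {m : List (Vec K)} (hm : m ∈ nodes Θ t) : 0 < μ.real (nodeEvent ξ m) := by
  induction t generalizing m with
  | zero =>
    obtain rfl : m = [] := by simpa [nodes] using hm
    simp [nodeEvent_nil]
  | succ t ih =>
    obtain ⟨z, hz, m, hm', rfl⟩ := mem_nodes_succ.1 hm
    have hl := length_of_mem_nodes hm'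
    rw [h1.nodeEvent_prob_cons (by omega), hl]
    exact mul_pos (h1.support_pos _ (by omega) ht z hz) (ih (by omega) hm')

theorem H1.transProb_eq [IsProbabilityMeasure μ] (h1 : H1 T μ ξ Θ ξ₁) {t : ℕ} (ht : t < T)
    {m : List (Vec K)} (hm : m ∈ nodes Θ t) (z : Vec K) :
    transProb μ ξ m z = stageProb μ ξ (t + 1) z := by
  have hl := length_of_mem_nodes hm
  have hpos := h1.nodeEvent_prob_pos ht.le hm
  have hms : MeasurableSet (nodeEvent ξ m) :=
    measurableSet_nodeEvent _ m fun t h2 h3 => h1.measurable t h2 (by omega)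
  have h := h1.nodeEvent_prob_cons (m := m) (by omega) z
  rw [nodeEvent_cons] at h
  rw [transProb, measureReal_def, cond_apply hms, ENNReal.toReal_mul, ENNReal.toReal_inv,
    ← measureReal_def, ← measureReal_def, h, hl]
  field_simp

/-- By independence, the nested problem is solved by the dynamic programming recursion. -/
theorem H1.nestedValue_eq [IsProbabilityMeasure μ] {P : Problem n K p q}
    (h1 : H1 P.T μ ξ Θ ξ₁) {r t : ℕ} (hrt : t + r = P.T) {m : List (Vec K)}
    (hm : m ∈ nodes Θ t) :
    nestedValue P μ ξ Θ r m = P.recourse Θ (stageProb μ ξ) (t + 1) := by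
  induction r generalizing t m with
  | zero =>
    obtain rfl : t = P.T := by omega
    rw [P.recourse_terminal]
    rfl
  | succ r ih =>
    funext x
    have hl := length_of_mem_nodes hm
    rw [nestedValue, hl, P.recourse_eq Θ _ (by omega)]
    refine Finset.sum_congr rfl fun z hz => ?_
    rw [h1.transProb_eq (by omega) hm, ih (by omega) (cons_mem_nodes.2 ⟨hz, hm⟩)]

theorem sum_nodes_succ (Θ : ℕ → Finset (Vec K)) (t : ℕ) (F : List (Vec K) → ℝ) :
    ∑ m ∈ nodes Θ (t + 1), F m = ∑ m ∈ nodes Θ t, ∑ z ∈ Θ (t + 1), F (z :: m) := by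
  rw [nodes, Finset.sum_image, Finset.sum_product_right]
  intro a _ b _ h
  obtain ⟨h1, h2⟩ := List.cons.inj h
  exact Prod.ext h1 h2

variable {P : Problem n K p q} {lam : ℕ → ℕ → ℝ} {Q₀ : ℕ → Vec n → EReal}

theorem IsFeasiblePolicy.mem_stateSet {u : List (Vec K) → Vec n} (hu : IsFeasiblePolicy P Θ u)
    {t : ℕ} (ht : t ≤ P.T) {m : List (Vec K)} (hm : m ∈ nodes Θ t) : u m ∈ P.stateSet t := by
  cases t with
  | zero =>
    obtain rfl : m = [] := by simpa [nodes] using hm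
    exact hu.root
  | succ t =>
    obtain ⟨z, hz, m', hm', rfl⟩ := mem_nodes_succ.1 hm
    exact (hu.feas t ht m' hm' z hz).1

/-- The expected cost of the first `r` stages of a policy plus the expected recourse. -/
def costTo (P : Problem n K p q) (μ : Measure Ω) (ξ : ℕ → Ω → Vec K) (Θ : ℕ → Finset (Vec K))
    (u : List (Vec K) → Vec n) (r : ℕ) : ℝ :=
  (∑ t ∈ Finset.range r, ∑ m ∈ nodes Θ t, ∑ z ∈ Θ (t + 1),
    μ.real (nodeEvent ξ (z :: m)) * (P.f (t + 1) (u m) (u (z :: m)) z).toReal) +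
  ∑ m ∈ nodes Θ r, μ.real (nodeEvent ξ m) *
    (P.recourse Θ (stageProb μ ξ) (r + 1) (u m)).toReal

theorem IsFeasiblePolicy.policyCost_eq_costTo {u : List (Vec K) → Vec n}
    (hu : IsFeasiblePolicy P Θ u) (h : Admissible P Θ (stageProb μ ξ) lam Q₀) :
    policyCost P μ ξ Θ u = costTo P μ ξ Θ u P.T := by
  rw [costTo, P.recourse_terminal]
  simp only [EReal.toReal_zero, mul_zero, Finset.sum_const_zero, add_zero]
  rw [policyCost, coe_real_sum]
  refine Finset.sum_congr rfl fun t ht => ?_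
  rw [coe_real_sum]
  refine Finset.sum_congr rfl fun m hm => ?_
  rw [coe_real_sum]
  refine Finset.sum_congr rfl fun z hz => ?_
  have ht := Finset.mem_range.1 ht
  rw [EReal.coe_mul, ← (h.h2 (t + 1) (by omega) (by omega)).coe_f hz
    (hu.mem_stateSet ht.le hm) (hu.feas t ht m hm z hz).1]

/-- `costTo` interpolates between the optimal value at `r = 0` and the policy cost at `r = P.T`. Its
increments are mean suboptimalities in the dynamic programming equations: nonnegative for every
feasible policy and zero when all infima are attained. -/
theorem H1.costTo_succ_sub (h1 : H1 P.T μ ξ Θ ξ₁) {u : List (Vec K) → Vec n}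
    (hu : IsFeasiblePolicy P Θ u) (h : Admissible P Θ (stageProb μ ξ) lam Q₀) {r : ℕ}
    (hr : r < P.T) :
    costTo P μ ξ Θ u (r + 1) - costTo P μ ξ Θ u r =
      ∑ m ∈ nodes Θ r, ∑ z ∈ Θ (r + 1), μ.real (nodeEvent ξ (z :: m)) *
        ((P.f (r + 1) (u m) (u (z :: m)) z).toReal +
          (P.recourse Θ (stageProb μ ξ) (r + 2) (u (z :: m))).toReal -
          (P.stageValue (r + 1) (P.recourse Θ (stageProb μ ξ) (r + 2)) (u m) z).toReal) := by
  have e : ∑ m ∈ nodes Θ r, μ.real (nodeEvent ξ m) *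
      (P.recourse Θ (stageProb μ ξ) (r + 1) (u m)).toReal =
      ∑ m ∈ nodes Θ r, ∑ z ∈ Θ (r + 1), μ.real (nodeEvent ξ (z :: m)) *
        (P.stageValue (r + 1) (P.recourse Θ (stageProb μ ξ) (r + 2)) (u m) z).toReal := by
    refine Finset.sum_congr rfl fun m hm => ?_
    have hl := length_of_mem_nodes hm
    rw [h.toReal_recourse (t := r + 1) (by omega) (by omega) (hu.mem_stateSet hr.le hm),
      Finset.mul_sum]
    refine Finset.sum_congr rfl fun z hz => ?_
    rw [h1.nodeEvent_prob_cons (by omega), hl]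
    ring
  simp only [costTo, Finset.sum_range_succ, sum_nodes_succ, e, mul_sub, mul_add,
    Finset.sum_sub_distrib, Finset.sum_add_distrib]
  ring

theorem H1.costTo_zero [IsProbabilityMeasure μ] (h1 : H1 P.T μ ξ Θ ξ₁)
    {u : List (Vec K) → Vec n} (hu : IsFeasiblePolicy P Θ u) (hT : 1 ≤ P.T)
    (h : Admissible P Θ (stageProb μ ξ) lam Q₀) :
    (costTo P μ ξ Θ u 0 : EReal) = P.stageValue 1 (P.recourse Θ (stageProb μ ξ) 2) P.x₀ ξ₁ := by
  have h2 := h1.sum_stageProb le_rfl hT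
  have hx : P.x₀ ∈ P.stateSet (1 - 1) := rfl
  rw [h1.first, Finset.sum_singleton] at h2
  rw [costTo, h.coe_stageValue le_rfl hT (by simp [h1.first]) hx]
  simp [nodes, nodeEvent_nil, hu.root, h.toReal_recourse le_rfl hT hx, h1.first, h2]

/-- No feasible policy has a smaller cost than the optimal value. -/
theorem H1.le_policyCost [IsProbabilityMeasure μ] (h1 : H1 P.T μ ξ Θ ξ₁)
    {u : List (Vec K) → Vec n} (hu : IsFeasiblePolicy P Θ u) (hT : 1 ≤ P.T)
    (h : Admissible P Θ (stageProb μ ξ) lam Q₀) :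
    P.stageValue 1 (P.recourse Θ (stageProb μ ξ) 2) P.x₀ ξ₁ ≤ policyCost P μ ξ Θ u := by
  rw [hu.policyCost_eq_costTo h, ← h1.costTo_zero hu hT h, EReal.coe_le_coe_iff]
  have key : ∀ r ≤ P.T, costTo P μ ξ Θ u 0 ≤ costTo P μ ξ Θ u r := by
    intro r hr
    induction r with
    | zero => exact le_rfl
    | succ r ih =>
      refine (ih (by omega)).trans (sub_nonneg.1 ?_)
      rw [h1.costTo_succ_sub hu h (by omega)]
      refine Finset.sum_nonneg fun m hm => Finset.sum_nonneg fun z hz =>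
        mul_nonneg measureReal_nonneg (sub_nonneg.2 ?_)
      have hf := hu.feas r (by omega) m hm z hz
      have hx : u m ∈ P.stateSet (r + 1 - 1) := hu.mem_stateSet (by omega) hm
      have hy : u (z :: m) ∈ P.stateSet (r + 1 + 1 - 1) := hf.1
      have := P.stageValue_le (P.recourse Θ (stageProb μ ξ) (r + 1 + 1)) hf
      rwa [h.coe_stageValue (by omega) (by omega) hz hx,
        (h.h2 (r + 1) (by omega) hr).coe_f hz hx hf.1,
        h.coe_recourse (by omega) (by omega) hy, ← EReal.coe_add, EReal.coe_le_coe_iff] at this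
  exact key P.T le_rfl

/-- Feasible policies attaining all infima of the dynamic programming equations are optimal. -/
theorem H1.isOptimalPolicy [IsProbabilityMeasure μ] (h1 : H1 P.T μ ξ Θ ξ₁)
    {u : List (Vec K) → Vec n} (hu : IsFeasiblePolicy P Θ u) (hT : 1 ≤ P.T)
    (h : Admissible P Θ (stageProb μ ξ) lam Q₀)
    (hatt : ∀ t < P.T, ∀ m ∈ nodes Θ t, ∀ z ∈ Θ (t + 1),
      P.f (t + 1) (u m) (u (z :: m)) z + P.recourse Θ (stageProb μ ξ) (t + 2) (u (z :: m)) =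
        P.stageValue (t + 1) (P.recourse Θ (stageProb μ ξ) (t + 2)) (u m) z) :
    IsOptimalPolicy P μ ξ Θ u ∧
      policyCost P μ ξ Θ u = P.stageValue 1 (P.recourse Θ (stageProb μ ξ) 2) P.x₀ ξ₁ := by
  have hcost : policyCost P μ ξ Θ u =
      P.stageValue 1 (P.recourse Θ (stageProb μ ξ) 2) P.x₀ ξ₁ := by
    rw [hu.policyCost_eq_costTo h, ← h1.costTo_zero hu hT h, EReal.coe_eq_coe_iff]
    have key : ∀ r ≤ P.T, costTo P μ ξ Θ u r = costTo P μ ξ Θ u 0 := by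
      intro r hr
      induction r with
      | zero => rfl
      | succ r ih =>
        rw [← ih (by omega), ← sub_eq_zero, h1.costTo_succ_sub hu h (by omega)]
        refine Finset.sum_eq_zero fun m hm => Finset.sum_eq_zero fun z hz => ?_
        have hf := hu.feas r (by omega) m hm z hz
        have hx : u m ∈ P.stateSet (r + 1 - 1) := hu.mem_stateSet (by omega) hm
        have hy : u (z :: m) ∈ P.stateSet (r + 1 + 1 - 1) := hf.1
        have := hatt r hr m hm z hz
        rw [h.coe_stageValue (by omega) (by omega) hz hx,
          (h.h2 (r + 1) (by omega) hr).coe_f hz hx hf.1,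
          h.coe_recourse (t := r + 1 + 1) (by omega) (by omega) hy, ← EReal.coe_add,
          EReal.coe_eq_coe_iff] at this
        rw [this, sub_self, mul_zero]
    exact key P.T le_rfl
  refine ⟨⟨hu, fun t ht m hm z hz => ?_, fun v hv => hcost ▸ h1.le_policyCost hv hT h⟩, hcost⟩
  rw [h1.nestedValue_eq (t := t + 1) (by omega) (cons_mem_nodes.2 ⟨hz, hm⟩)]
  exact hatt t ht m hm z hz

end NoiseProcess

/-! ### Limits of errors, first-stage values and decisions. -/

section Limits

variable {P : Problem n K p q} {Θ : ℕ → Finset (Vec K)} {pr : ℕ → Vec K → ℝ}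
  {lam : ℕ → ℕ → ℝ} {Q₀ : ℕ → Vec n → EReal} {s : ℕ → ℕ → Vec K}
  {visited : ℕ → List (Vec K) → Prop} {R : Iterates n K} {t : ℕ}

theorem IsExecution.gap_succ_le (hR : IsExecution P Θ pr lam Q₀ s visited R)
    (hs : IsPath P Θ s visited) (h : Admissible P Θ pr lam Q₀) (ht : 2 ≤ t) (htT : t ≤ P.T + 1)
    (k : ℕ) {x : Vec n} (hx : x ∈ P.stateSet (t - 1)) :
    gap P Θ pr R (k + 2) t x ≤ gap P Θ pr R (k + 1) t x := by
  rcases Nat.lt_or_ge P.T t with h' | h'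
  · obtain rfl : t = P.T + 1 := by omega
    simp [gap, hR.terminal]
  · have hb := hR.bracketed hs h ht htT
    obtain ⟨c, L, hc, -⟩ := hR.exists_cuts hs h ht h' (hR.bracketed hs h (by omega) (by omega))
    refine sub_le_sub_left ?_ _
    rw [← EReal.coe_le_coe_iff, ← hb.coe_Q h (by omega) htT k hx,
      ← hb.coe_Q h (by omega) htT (k + 1) hx, hc (k + 1)]
    exact le_max_left _ _

/-- The errors at the decisions computed at a node of stage `t` vanish asymptotically. -/
theorem IsExecution.tendsto_gap (hR : IsExecution P Θ pr lam Q₀ s visited R)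
    (hs : IsPath P Θ s visited) (h : Admissible P Θ pr lam Q₀) {m : List (Vec K)} {z : Vec K}
    (htT : t < P.T) (hm : m ∈ nodes Θ t) (hz : z ∈ Θ (t + 1))
    (hgap : ∀ ε > 0, ∀ᶠ k in atTop, visited (k + 1) m →
      gap P Θ pr R k (t + 2) (R.x (k + 1) (z :: m)) < ε) :
    Tendsto (fun k => gap P Θ pr R (k + 1) (t + 2) (R.x (k + 2) (z :: m)))
      (atTop ⊓ 𝓟 {k | visited (k + 2) m}) (𝓝 0) := by
  refine tendsto_order.2 ⟨fun a ha => ?_, fun a ha => ?_⟩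
  · rw [eventually_inf_principal]
    refine .of_forall fun k hk => ha.trans_le ?_
    exact (hR.bracketed hs h (by omega) (by omega)).gap_nonneg h (by omega) (by omega) k
      (hR.x_mem htT hm hk hz)
  · rw [eventually_inf_principal]
    exact (tendsto_add_atTop_nat 1).eventually (hgap a ha)

/-- The hypothesis concerns the approximation before the update of the same iteration, the
conclusion the one after it. Updating only shrinks the error, which stays nonnegative. -/
theorem IsExecution.tendsto_recourse_sub (hR : IsExecution P Θ pr lam Q₀ s visited R)
    (hs : IsPath P Θ s visited) (h : Admissible P Θ pr lam Q₀) {m : List (Vec K)} {z : Vec K}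
    (htT : t < P.T) (hm : m ∈ nodes Θ t) (hz : z ∈ Θ (t + 1))
    (hgap : ∀ ε > 0, ∀ᶠ k in atTop, visited (k + 1) m →
      gap P Θ pr R k (t + 2) (R.x (k + 1) (z :: m)) < ε) :
    Tendsto (fun k => P.recourse Θ pr (t + 2) (R.x k (z :: m)) - R.Q k (t + 2) (R.x k (z :: m)))
      (atTop ⊓ 𝓟 {k | 1 ≤ k ∧ visited k m}) (𝓝 0) := by
  have hb := hR.bracketed hs h (t := t + 2) (by omega) (by omega)
  have hx : ∀ k, visited (k + 1) m → R.x (k + 1) (z :: m) ∈ P.stateSet (t + 2 - 1) :=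
    fun k hk => hR.x_mem htT hm hk hz
  have hreal : Tendsto (fun k => gap P Θ pr R k (t + 2) (R.x k (z :: m)))
      (atTop ⊓ 𝓟 {k | 1 ≤ k ∧ visited k m}) (𝓝 0) := by
    refine tendsto_order.2 ⟨fun a ha => ?_, fun a ha => ?_⟩
    · rw [eventually_inf_principal]
      refine .of_forall fun k hk => ha.trans_le ?_
      obtain ⟨k, rfl⟩ : ∃ i, k = i + 1 := ⟨k - 1, by have := hk.1; omega⟩
      exact hb.gap_nonneg h (by omega) (by omega) k (hx k hk.2)
    · rw [eventually_inf_principal]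
      filter_upwards [(tendsto_sub_atTop_nat 1).eventually (hgap a ha), eventually_ge_atTop 2]
        with k h1 h2 hk
      obtain ⟨k, rfl⟩ : ∃ i, k = i + 2 := ⟨k - 2, by omega⟩
      exact (hR.gap_succ_le hs h (by omega) (by omega) k (hx _ hk.2)).trans_lt (h1 hk.2)
  have := (continuous_coe_real_ereal.tendsto 0).comp hreal
  rw [EReal.coe_zero] at this
  refine this.congr' ?_
  rw [EventuallyEq, eventually_inf_principal]
  refine .of_forall fun k hk => ?_
  obtain ⟨k, rfl⟩ : ∃ i, k = i + 1 := ⟨k - 1, by have := hk.1; omega⟩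
  exact (hb.recourse_sub_eq_gap h (by omega) (by omega) k (hx k hk.2)).symm

/-- Convergence of the optimal values of the first stage problems. -/
theorem IsExecution.tendsto_first_stage (hR : IsExecution P Θ pr lam Q₀ s visited R)
    (hs : IsPath P Θ s visited) (h : Admissible P Θ pr lam Q₀) (hT : 1 ≤ P.T) {z : Vec K}
    (hz : z ∈ Θ 1)
    (hgap : ∀ ε > 0, ∀ᶠ k in atTop, visited (k + 1) [] →
      gap P Θ pr R k 2 (R.x (k + 1) [z]) < ε) :
    Tendsto (fun k => regObj P 1 (R.Q k 2) (lam 1 (k + 1)) (R.prox (k + 1) 1) P.x₀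
      (R.x (k + 1) [z]) z) atTop (𝓝 (P.stageValue 1 (P.recourse Θ pr 2) P.x₀ z)) ∧
    Tendsto (fun k => P.stageValue 1 (R.Q k 2) P.x₀ z) atTop
      (𝓝 (P.stageValue 1 (P.recourse Θ pr 2) P.x₀ z)) := by
  obtain ⟨D, hD⟩ := exists_sq_norm_sub_le (h.h2 1 le_rfl hT).X_compact
  have hv : ∀ k, visited k [] := fun k => hs.visited_of_sampled k [] rfl
  have hroot : ([] : List (Vec K)) ∈ nodes Θ 0 := by simp [nodes]
  have hg := (hR.tendsto_gap hs h (t := 0) hT hroot hz hgap).mono_left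
    (le_inf le_rfl (le_principal_iff.2 (univ_mem' fun k => hv (k + 2))))
  have hl : Tendsto (fun k => lam 1 (k + 2) * D) atTop (𝓝 0) := by
    have := ((h.lam_lim 1 le_rfl hT).comp (tendsto_add_atTop_nat 2)).mul_const D
    rwa [zero_mul] at this
  have hx : P.x₀ ∈ P.stateSet (1 - 1) := rfl
  set v := (P.stageValue 1 (P.recourse Θ pr 2) P.x₀ z).toReal with hvdef
  have ev : P.stageValue 1 (P.recourse Θ pr 2) P.x₀ z = v := h.coe_stageValue le_rfl hT hz hx
  have hbounds : ∀ k, ∃ ρ σ : ℝ,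
      regObj P 1 (R.Q (k + 1) 2) (lam 1 (k + 2)) (R.prox (k + 2) 1) P.x₀
        (R.x (k + 2) [z]) z = ρ ∧
      P.stageValue 1 (R.Q (k + 1) 2) P.x₀ z = σ ∧
      v - gap P Θ pr R (k + 1) 2 (R.x (k + 2) [z]) ≤ ρ ∧ ρ ≤ σ + lam 1 (k + 2) * D ∧ σ ≤ v := by
    intro k
    have hxk : R.x (k + 2) [] ∈ P.stateSet 0 := hR.root _
    obtain ⟨ρ, σ, v', φ, h1, h2, h3, -, h5, h6, h7, h8⟩ :=
      hR.stage_bounds hs h (t := 0) hT hD hroot (hv (k + 2)) hxk hz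
    rw [hR.root] at h1 h2 h3
    have hv' : v = v' := by rw [hvdef, ← EReal.toReal_coe v', ← h3]
    refine ⟨ρ, σ, h1, h2, ?_, h6, hv' ▸ h7⟩
    rw [gap, hv']
    simp only [zero_add] at h5 h8
    linarith
  choose ρ σ hρ hσ h1 h2 h3 using hbounds
  rw [ev]
  constructor
  -- The first term is dropped since $\mathcal Q_2^0$ may be infinite; the rest is squeezed by
  -- $v-\mathrm{gap}\le\rho\le\sigma+\lambda D\le v+\lambda D$.
  · rw [← tendsto_add_atTop_iff_nat 1]
    refine Tendsto.congr (fun k => (hρ k).symm) (EReal.tendsto_coe.2 ?_)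
    refine tendsto_of_tendsto_of_tendsto_of_le_of_le (by simpa using hg.const_sub v)
      (by simpa using hl.const_add v) h1 fun k => ?_
    exact (h2 k).trans (by linarith [h3 k])
  · rw [← tendsto_add_atTop_iff_nat 1]
    refine Tendsto.congr (fun k => (hσ k).symm) (EReal.tendsto_coe.2 ?_)
    refine tendsto_of_tendsto_of_tendsto_of_le_of_le (g := fun k =>
      v - gap P Θ pr R (k + 1) 2 (R.x (k + 2) [z]) - lam 1 (k + 2) * D)
      (by simpa using (hg.const_sub v).sub hl) tendsto_const_nhds (fun k => ?_) h3
    have := (h1 k).trans (h2 k)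
    beta_reduce
    linarith

/-- Accumulation points of the decisions are feasible and solve the dynamic programming
equations. -/
theorem IsExecution.cluster_point_optimal
    (hR : IsExecution P Θ pr lam Q₀ s (fun _ _ => True) R)
    (hs : IsPath P Θ s fun _ _ => True) (h : Admissible P Θ pr lam Q₀)
    (hgap : ∀ t, 1 ≤ t → t ≤ P.T → ∀ m z, z :: m ∈ nodes Θ t → ∀ ε > 0, ∀ᶠ k in atTop,
      True → gap P Θ pr R k (t + 1) (R.x (k + 1) (z :: m)) < ε)
    {u : List (Vec K) → Vec n} (hu : MapClusterPt (fun m : treeNodes Θ P.T => u m) atTop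
      (fun k (m : treeNodes Θ P.T) => R.x k m)) :
    IsFeasiblePolicy P Θ u ∧ ∀ t < P.T, ∀ m ∈ nodes Θ t, ∀ z ∈ Θ (t + 1),
      P.f (t + 1) (u m) (u (z :: m)) z + P.recourse Θ pr (t + 2) (u (z :: m)) =
        P.stageValue (t + 1) (P.recourse Θ pr (t + 2)) (u m) z := by
  -- Along an ultrafilter the decisions at all nodes converge simultaneously, so no subsequences are
  -- needed.
  obtain ⟨U, hU, hlim⟩ := mapClusterPt_iff_ultrafilter.1 hu
  have hx : ∀ t ≤ P.T, ∀ m ∈ nodes Θ t, Tendsto (fun k => R.x k m) U (𝓝 (u m)) :=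
    fun t ht m hm => (tendsto_pi_nhds.1 hlim) ⟨m, t, ht, hm⟩
  have hmemk : ∀ t ≤ P.T, ∀ m ∈ nodes Θ t, ∀ k, R.x (k + 1) m ∈ P.stateSet t := by
    intro t ht m hm k
    cases t with
    | zero =>
      obtain rfl : m = [] := by simpa [nodes] using hm
      exact hR.root _
    | succ t =>
      obtain ⟨z, hz, m', hm', rfl⟩ := mem_nodes_succ.1 hm
      exact hR.x_mem ht hm' trivial hz
  have hge : ∀ N, ∀ᶠ k in (U : Filter ℕ), N ≤ k := fun N => hU (eventually_ge_atTop N)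
  have hfeas : IsFeasiblePolicy P Θ u := by
    refine ⟨?_, fun t ht m hm z hz => ?_⟩
    · have h1 := hx 0 (by omega) [] (by simp [nodes])
      simp only [hR.root] at h1
      exact tendsto_nhds_unique h1 tendsto_const_nhds
    · have hz' := cons_mem_nodes.2 ⟨hz, hm⟩
      refine ((h.h2 (t + 1) (by omega) ht).isClosed_graph hz).mem_of_tendsto
        ((hx t ht.le m hm).prodMk_nhds (hx (t + 1) ht _ hz')) ?_
      filter_upwards [hge 1] with k hk
      obtain ⟨k, rfl⟩ : ∃ i, k = i + 1 := ⟨k - 1, by omega⟩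
      exact (hR.forward k t ht m hm trivial z hz).1
  refine ⟨hfeas, fun t ht m hm z hz => ?_⟩
  have hz' := cons_mem_nodes.2 ⟨hz, hm⟩
  have hH := h.h2 (t + 1) (by omega) ht
  have hf := hfeas.feas t ht m hm z hz
  refine le_antisymm ?_ (P.stageValue_le (P.recourse Θ pr (t + 1 + 1)) hf)
  have hum : u m ∈ P.stateSet (t + 1 - 1) := by
    cases t with
    | zero =>
      obtain rfl : m = [] := by simpa [nodes] using hm
      exact hfeas.root
    | succ t =>
      obtain ⟨w, hw, m', hm', rfl⟩ := mem_nodes_succ.1 hm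
      exact (hfeas.feas t (by omega) m' hm' w hw).1
  have huz : u (z :: m) ∈ P.stateSet (t + 1 + 1 - 1) := hf.1
  have ef := hH.coe_f hz hum hf.1
  have eW := h.coe_recourse (t := t + 1 + 1) (by omega) (by omega) huz
  have ev := h.coe_stageValue (t := t + 1) (by omega) ht hz hum
  rw [ef, eW, ev, ← EReal.coe_add, EReal.coe_le_coe_iff]
  refine le_of_forall_pos_le_add fun ε hε => ?_
  obtain ⟨D, hD⟩ := exists_sq_norm_sub_le hH.X_compact
  obtain ⟨δ, hδ, hreg⟩ := stageValue_recourse_regular h.h2 h.pr_nonneg (t := t + 1) (by omega) ht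
  have hxm := hx t ht.le m hm
  have hxz := hx (t + 1) ht _ hz'
  have hvlim : Tendsto (fun k =>
      (P.stageValue (t + 1) (P.recourse Θ pr (t + 2)) (R.x k m) z).toReal) U
      (𝓝 (P.stageValue (t + 1) (P.recourse Θ pr (t + 2)) (u m) z).toReal) := by
    have hopen : IsOpen (P.stateSet (t + 1 - 1) + Metric.ball (0 : Vec n) δ) :=
      Metric.isOpen_ball.add_left
    exact ((hreg z hz).1.continuousAt (hopen.mem_nhds (subset_add_ball _ hδ hum))).tendsto.comp hxm
  have hWlim : Tendsto (fun k => (P.recourse Θ pr (t + 2) (R.x k (z :: m))).toReal) U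
      (𝓝 (P.recourse Θ pr (t + 2) (u (z :: m))).toReal) := by
    refine ((recourse_regular h.h2 h.pr_nonneg (t := t + 2) (by omega) (by omega)).1
      _ huz).tendsto.comp (tendsto_nhdsWithin_iff.2 ⟨hxz, ?_⟩)
    filter_upwards [hge 1] with k hk
    obtain ⟨k, rfl⟩ : ∃ i, k = i + 1 := ⟨k - 1, by omega⟩
    exact hmemk (t + 1) ht _ hz' k
  have hflim : ∀ᶠ k in U, (((P.f (t + 1) (u m) (u (z :: m)) z).toReal - ε / 3 : ℝ) : EReal) <
      P.f (t + 1) (R.x k m) (R.x k (z :: m)) z := by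
    refine (hxm.prodMk_nhds hxz).eventually (hH.f_lsc z hz (u m, u (z :: m)) _ ?_)
    beta_reduce
    rw [gt_iff_lt, ef, EReal.toReal_coe, EReal.coe_lt_coe_iff]
    linarith
  have hlam : ∀ᶠ k in U, lam (t + 1) k * D < ε / 3 := by
    have := (h.lam_lim (t + 1) (by omega) ht).mul_const D
    rw [zero_mul] at this
    exact hU (this.eventually_lt_const (by linarith))
  have hg : ∀ᶠ k in U, gap P Θ pr R (k - 1) (t + 2) (R.x (k - 1 + 1) (z :: m)) < ε / 3 := by
    refine hU ?_
    filter_upwards [(tendsto_sub_atTop_nat 1).eventually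
      (hgap (t + 1) (by omega) ht m z hz' (ε / 3) (by linarith))] with k hk
    exact hk trivial
  -- Each third of `ε` pays for one loss: lower semicontinuity of the cost, the penalty, and the
  -- gap.
  refine le_of_tendsto_of_tendsto (hWlim.const_add _) (hvlim.add_const ε) ?_
  filter_upwards [hflim, hlam, hg, hge 2] with k h1 h2 h3 hk
  obtain ⟨k, rfl⟩ : ∃ i, k = i + 2 := ⟨k - 2, by omega⟩
  obtain ⟨ρ, σ, v, φ, -, -, hv, hφ, h5, h6, h7, -⟩ := hR.stage_bounds hs h ht hD hm trivial
    (hmemk t ht.le m hm (k + 1)) hz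
  rw [hφ, EReal.coe_lt_coe_iff] at h1
  have h3' : gap P Θ pr R (k + 1) (t + 2) (R.x (k + 2) (z :: m)) < ε / 3 := h3
  rw [gap] at h3'
  rw [hv, EReal.toReal_coe]
  linarith

end Limits



end SREDA

end

/-! ### The convergence theorem. -/

theorem theorem4p2 {n K p q : ℕ} {Ω : Type*} [MeasurableSpace Ω] (μ : Measure Ω)
    [IsProbabilityMeasure μ]
    (P : SREDA.Problem n K p q) (hT : 1 ≤ P.T)
    (ξ : ℕ → Ω → SREDA.Vec K) (Θ : ℕ → Finset (SREDA.Vec K)) (ξ₁ : SREDA.Vec K)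
    (s : ℕ → ℕ → Ω → SREDA.Vec K)
    (h1 : SREDA.H1 P.T μ ξ Θ ξ₁)
    (h2 : ∀ t, 1 ≤ t → t ≤ P.T → SREDA.H2 P Θ t)
    (h3 : SREDA.H3 P.T μ ξ Θ s)
    -- penalties
    (lam : ℕ → ℕ → ℝ)
    (hlam_nonneg : ∀ t k, 1 ≤ t → t ≤ P.T → 1 ≤ k → 0 ≤ lam t k)
    (hlam_first : ∀ t, 1 ≤ t → t ≤ P.T → lam t 1 = 0)
    (hlam_last : ∀ k, 1 ≤ k → lam P.T k = 0)
    (hlam_lim : ∀ t, 1 ≤ t → t < P.T → Tendsto (lam t) atTop (𝓝 0))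
    -- initial lower approximations of the recourse functions
    (Q₀ : ℕ → SREDA.Vec n → EReal)
    (hQ₀ : ∀ t, 2 ≤ t → t ≤ P.T → ∀ x ∈ P.X (t - 1),
      Q₀ t x ≤ P.recourse Θ (SREDA.stageProb μ ξ) t x) :
    -- the first stage value of the dynamic programming equations is the optimal value
    P.stageValue 1 (P.recourse Θ (SREDA.stageProb μ ξ) 2) P.x₀ ξ₁ =
        SREDA.nestedValue P μ ξ Θ P.T [] P.x₀ ∧
    -- SREDA
    (∀ R : Ω → SREDA.Iterates n K, SREDA.IsSREDA P Θ (SREDA.stageProb μ ξ) lam Q₀ s R →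
      (∀ᵐ ω ∂μ, ∀ t, 2 ≤ t → t ≤ P.T + 1 → ∀ m ∈ SREDA.nodes Θ (t - 1),
        Tendsto (fun k => P.recourse Θ (SREDA.stageProb μ ξ) t ((R ω).x k m) -
          (R ω).Q k t ((R ω).x k m)) atTop (𝓝 0)) ∧
      (∀ᵐ ω ∂μ,
        Tendsto (fun k => SREDA.regObj P 1 ((R ω).Q k 2) (lam 1 (k + 1)) ((R ω).prox (k + 1) 1)
            P.x₀ ((R ω).x (k + 1) [ξ₁]) ξ₁) atTop
          (𝓝 (P.stageValue 1 (P.recourse Θ (SREDA.stageProb μ ξ) 2) P.x₀ ξ₁)) ∧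
        Tendsto (fun k => P.stageValue 1 ((R ω).Q k 2) P.x₀ ξ₁) atTop
          (𝓝 (P.stageValue 1 (P.recourse Θ (SREDA.stageProb μ ξ) 2) P.x₀ ξ₁))) ∧
      (∀ᵐ ω ∂μ, ∀ u : List (SREDA.Vec K) → SREDA.Vec n,
        MapClusterPt (fun m : SREDA.treeNodes Θ P.T => u m) atTop
          (fun k (m : SREDA.treeNodes Θ P.T) => (R ω).x k m) →
        SREDA.IsOptimalPolicy P μ ξ Θ u ∧
          SREDA.policyCost P μ ξ Θ u =
            P.stageValue 1 (P.recourse Θ (SREDA.stageProb μ ξ) 2) P.x₀ ξ₁)) ∧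
    -- SDDP-REG
    (∀ R : Ω → SREDA.Iterates n K, SREDA.IsSDDPREG P Θ (SREDA.stageProb μ ξ) lam Q₀ s R →
      (∀ᵐ ω ∂μ, ∀ t, 2 ≤ t → t ≤ P.T + 1 → ∀ m ∈ SREDA.nodes Θ (t - 1),
        {k | 1 ≤ k ∧ SREDA.Sampled s ω k m.tail}.Infinite ∧
        Tendsto (fun k => P.recourse Θ (SREDA.stageProb μ ξ) t ((R ω).x k m) -
          (R ω).Q k t ((R ω).x k m))
          (atTop ⊓ 𝓟 {k | 1 ≤ k ∧ SREDA.Sampled s ω k m.tail}) (𝓝 0)) ∧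
      (∀ᵐ ω ∂μ,
        Tendsto (fun k => SREDA.regObj P 1 ((R ω).Q k 2) (lam 1 (k + 1)) ((R ω).prox (k + 1) 1)
            P.x₀ ((R ω).x (k + 1) [ξ₁]) ξ₁) atTop
          (𝓝 (P.stageValue 1 (P.recourse Θ (SREDA.stageProb μ ξ) 2) P.x₀ ξ₁)) ∧
        Tendsto (fun k => P.stageValue 1 ((R ω).Q k 2) P.x₀ ξ₁) atTop
          (𝓝 (P.stageValue 1 (P.recourse Θ (SREDA.stageProb μ ξ) 2) P.x₀ ξ₁)))) := by
  have hadm : SREDA.Admissible P Θ (SREDA.stageProb μ ξ) lam Q₀ := by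
    refine ⟨h2, fun t ht htT z hz => (h1.support_pos t ht htT z hz).le,
      fun t ht htT => h1.sum_stageProb ht htT, hlam_nonneg, fun t ht htT => ?_, hQ₀⟩
    rcases htT.lt_or_eq with h | rfl
    · exact hlam_lim t ht h
    · refine tendsto_const_nhds.congr' ?_
      filter_upwards [eventually_ge_atTop 1] with k hk
      exact (hlam_last k hk).symm
  have hξ₁ : ξ₁ ∈ Θ 1 := by simp [h1.first]
  have hpath : ∀ visited : Ω → ℕ → List (SREDA.Vec K) → Prop,
      (∀ ω k m, SREDA.Sampled s ω k m → visited ω k m) → ∀ ω,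
        SREDA.IsPath P Θ (fun k t => s k t ω) (visited ω) := fun visited hv ω =>
    ⟨fun k t hk ht htT => h3.mem_support k t hk ht htT ω, fun k m hm => hv ω k m hm⟩
  have hnode : ∀ t, 2 ≤ t → t ≤ P.T + 1 → ∀ m ∈ SREDA.nodes Θ (t - 1),
      ∃ r z m', t = r + 2 ∧ r < P.T ∧ m = z :: m' ∧ z ∈ Θ (r + 1) ∧ m' ∈ SREDA.nodes Θ r := by
    intro t ht htT m hm
    obtain ⟨r, rfl⟩ : ∃ r, t = r + 2 := ⟨t - 2, by omega⟩
    obtain ⟨z, hz, m', hm', rfl⟩ := SREDA.mem_nodes_succ.1 hm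
    exact ⟨r, z, m', rfl, by omega, rfl, hz, hm'⟩
  refine ⟨?_, fun R hR => ?_, fun R hR => ?_⟩
  · rw [h1.nestedValue_eq (t := 0) (by omega) (by simp [SREDA.nodes]),
      P.recourse_eq Θ _ (by omega), h1.first, Finset.sum_singleton]
    have := h1.sum_stageProb le_rfl hT
    rw [h1.first, Finset.sum_singleton] at this
    rw [this, EReal.coe_one, one_mul]
  · have hv : ∀ ω k m, SREDA.Sampled s ω k m → True := fun _ _ _ _ => trivial
    have hgap := hR.ae_eventually_gap_lt hadm h3 h1.first hv
    refine ⟨?_, ?_, ?_⟩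
    · filter_upwards [hgap] with ω hω t ht htT m hm
      obtain ⟨r, z, m', rfl, hr, rfl, hz, hm'⟩ := hnode t ht htT m hm
      refine ((hR.execution ω).tendsto_recourse_sub (hpath _ hv ω) hadm hr hm' hz
        (hω (r + 1) (by omega) hr m' z hm)).mono_left (le_inf le_rfl (le_principal_iff.2 ?_))
      filter_upwards [eventually_ge_atTop 1] with k hk
      exact ⟨hk, trivial⟩
    · filter_upwards [hgap] with ω hω
      exact (hR.execution ω).tendsto_first_stage (hpath _ hv ω) hadm hT hξ₁
        (hω 1 le_rfl hT [] ξ₁ (SREDA.cons_mem_nodes.2 ⟨hξ₁, by simp [SREDA.nodes]⟩))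
    · filter_upwards [hgap] with ω hω u hu
      obtain ⟨hf, hatt⟩ := (hR.execution ω).cluster_point_optimal (hpath _ hv ω) hadm hω hu
      exact h1.isOptimalPolicy hf hT hadm hatt
  · have hgap := hR.ae_eventually_gap_lt hadm h3 h1.first fun _ _ _ h => h
    refine ⟨?_, ?_⟩
    · have hinf : ∀ᵐ ω ∂μ, ∀ r, ∀ m ∈ SREDA.nodes Θ r, r ≤ P.T →
          ∃ᶠ k in atTop, SREDA.Sampled s ω (k + 1) m := by
        refine ae_all_iff.2 fun r => (ae_ball_iff (SREDA.nodes Θ r).countable_toSet).2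
          fun m hm => ?_
        by_cases hr : r ≤ P.T
        -- With the sure event as past event, recurrence says that every node is sampled infinitely
        -- often.
        · filter_upwards [h3.ae_frequently_sampled h1.first hr hm (A := fun _ => Set.univ)
            fun _ _ _ _ _ => trivial] with ω hω _
          exact (hω (Frequently.of_forall fun _ => trivial)).mono fun k hk => hk.2
        · exact .of_forall fun ω h => absurd h hr
      filter_upwards [hgap, hinf] with ω hω hfreq t ht htT m hm
      obtain ⟨r, z, m', rfl, hr, rfl, hz, hm'⟩ := hnode t ht htT m hm
      refine ⟨?_, (hR.execution ω).tendsto_recourse_sub (hpath _ (fun _ _ _ h => h) ω) hadm hr hm'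
        hz (hω (r + 1) (by omega) hr m' z hm)⟩
      refine Nat.frequently_atTop_iff_infinite.1 (frequently_atTop.2 fun N => ?_)
      obtain ⟨k, hk, hs⟩ := frequently_atTop.1 (hfreq r m' hm' hr.le) N
      exact ⟨k + 1, by omega, by omega, hs⟩
    · filter_upwards [hgap] with ω hω
      exact (hR.execution ω).tendsto_first_stage (hpath _ (fun _ _ _ h => h) ω) hadm hT hξ₁
        (hω 1 le_rfl hT [] ξ₁ (SREDA.cons_mem_nodes.2 ⟨hξ₁, by simp [SREDA.nodes]⟩))
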